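/- Let $c,d$ be positive integers, let $G=\operatorname{BS}(c,d)=\langle a,b : ab^c=b^da\rangle$, and let $P$ be the submonoid of $G$ generated by $a$ and $b$. Write $g\le h$ if $g^{-1}h\in P$. Then $(G,P)$ is a quasi-lattice ordered group, that is, $P\cap P^{-1}=\{e\}$ and any $g,h\in G$ with a common upper bound in $P$ have a least common upper bound $g\vee h$ in $P$ (for $x,y\in P$ we write $x\vee y=\infty$ if $x,y$ have no common upper bound in $P$). A Nica-covariant representation of $P$ in a unital $C^*$-algebra $B$ is a monoid homomorphism $V:P\to B$ such that $V_x^*V_x=1$ for all $x\in P$, and such that for all $x,y\in P$ the product $V_xV_x^*V_yV_y^*$ equals $V_{x\vee y}V_{x\vee y}^*$ if $x\vee y<\infty$ and $0$ if $x\vee y=\infty$. Let $C^*(G,P)$ be the $C^*$-algebra generated by a universal Nica-covariant representation $i:P\to C^*(G,P)$, and let $\mathcal T(P)\subset B(\ell^2(P))$ be the Toeplitz algebra, the $C^*$-algebra generated by the isometries $T_x$ ($x\in P$) with $T_xe_y=e_{xy}$ for $y\in P$. The Toeplitz representation is the unital $*$-homomorphism $\pi_T:C^*(G,P)\to\mathcal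 T(P)$ such that $\pi_T(i(x))=T_x$ for all $x\in P$. (1) $(G,P)$ is amenable in the sense of Nica: there is a linear contraction $\Phi:C^*(G,P)\to\overline{\operatorname{span}}\{i(x)i(x)^*:x\in P\}$ such that $\Phi(i(x)i(x)^*)=i(x)i(x)^*$ for all $x\in P$ and $\Phi(i(x)i(y)^*)=0$ whenever $x,y\in P$ and $x\ne y$, and $\Phi$ is faithful: if $R\in C^*(G,P)$ and $\Phi(R^*R)=0$, then $R=0$. (2) The Toeplitz representation $\pi_T:C^*(G,P)\to\mathcal T(P)$ is faithful, that is, injective. -/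

import Mathlib

universe u

noncomputable section

/-! ### Quasi-lattice ordered groups -/

namespace QuasiLattice

variable {G : Type u} [Group G]

/-- The left-invariant order of the pair `(G, P)`: `g ≤ h` if and only if `g⁻¹ h ∈ P`. -/
def PLe (P : Submonoid G) (g h : G) : Prop := g⁻¹ * h ∈ P

/-- `w` is a common upper bound of `g` and `h` in `P`. -/
def IsUpper (P : Submonoid G) (g h w : G) : Prop := w ∈ P ∧ PLe P g w ∧ PLe P h w

/-- `z` is the least common upper bound `g ∨ h` of `g` and `h` in `P`. -/
def IsJoin (P : Submonoid G) (g h z : G) : Prop :=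
  IsUpper P g h z ∧ ∀ w, IsUpper P g h w → PLe P z w

/-- `(G, P)` is a quasi-lattice ordered group: `P ∩ P⁻¹ = {e}`, and every pair `g, h` in `G` with a
common upper bound in `P` has a least common upper bound in `P`. -/
structure IsQuasiLatticeOrdered (P : Submonoid G) : Prop where
  eq_one : ∀ x, x ∈ P → x⁻¹ ∈ P → x = 1
  exists_join : ∀ g h, (∃ w, IsUpper P g h w) → ∃ z, IsJoin P g h z

/-- A Nica-covariant isometric representation of `P` in a unital C⋆-algebra `B`. -/
structure NicaRep (P : Submonoid G) (B : Type u) [CStarAlgebra B] where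
  /-- the underlying homomorphism of monoids -/
  toHom : P →* B
  isometry : ∀ x, star (toHom x) * toHom x = 1
  /-- Nica covariance when `x ∨ y < ∞`. -/
  cov_join : ∀ x y z : P, IsJoin P (x : G) y z →
    toHom x * star (toHom x) * (toHom y * star (toHom y)) = toHom z * star (toHom z)
  /-- Nica covariance when `x ∨ y = ∞`. -/
  cov_infty : ∀ x y : P, (¬ ∃ w, IsUpper P (x : G) y w) →
    toHom x * star (toHom x) * (toHom y * star (toHom y)) = 0

/-! ### The free unital ⋆-algebra on symbols `v_x`, `x ∈ P`, over `ℂ` -/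

/-- Words in the symbols `v_x = (x, false)` and `v_x⋆ = (x, true)`. -/
abbrev Word (P : Submonoid G) : Type u := FreeMonoid (P × Bool)

/-- The adjoint of a word: reverse it and replace each letter by its adjoint. -/
def Word.adj {P : Submonoid G} (w : Word P) : Word P :=
  FreeMonoid.map (fun l : P × Bool => (l.1, !l.2)) (star w)

theorem Word.adj_mul {P : Submonoid G} (v w : Word P) : (v * w).adj = w.adj * v.adj := by
  simp [Word.adj]

theorem Word.adj_one {P : Submonoid G} : (1 : Word P).adj = 1 := by
  simp [Word.adj]

theorem Word.adj_of {P : Submonoid G} (l : P × Bool) :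
    Word.adj (FreeMonoid.of l) = FreeMonoid.of (l.1, !l.2) := by
  simp [Word.adj]

theorem Word.adj_adj {P : Submonoid G} (w : Word P) : w.adj.adj = w := by
  induction w using FreeMonoid.recOn with
  | one => simp [Word.adj_one]
  | of_mul l w ih => rw [Word.adj_mul, Word.adj_mul, ih, Word.adj_of, Word.adj_of]; simp

/-- The free unital ⋆-algebra generated by the symbols `v_x`: linear combinations of words. -/
def FreeStarAlg (P : Submonoid G) : Type u := MonoidAlgebra ℂ (Word P)

namespace FreeStarAlg

variable {P : Submonoid G}

instance : Ring (FreeStarAlg P) := inferInstanceAs (Ring (MonoidAlgebra ℂ (Word P)))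

instance : Algebra ℂ (FreeStarAlg P) := inferInstanceAs (Algebra ℂ (MonoidAlgebra ℂ (Word P)))

/-- The multiple `r • w` of the word `w`. -/
def mono (w : Word P) (r : ℂ) : FreeStarAlg P := MonoidAlgebra.single w r

theorem mono_mul (v w : Word P) (r s : ℂ) : mono v r * mono w s = mono (v * w) (r * s) :=
  MonoidAlgebra.single_mul_single v w r s

theorem smul_mono (a : ℂ) (w : Word P) (r : ℂ) : a • mono w r = mono w (a * r) :=
  MonoidAlgebra.smul_single' a w r

theorem one_eq : (1 : FreeStarAlg P) = mono 1 1 := rfl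

theorem induct {p : FreeStarAlg P → Prop} (a : FreeStarAlg P) (h0 : p 0)
    (hadd : ∀ a b, p a → p b → p (a + b)) (hm : ∀ w r, p (mono w r)) : p a :=
  MonoidAlgebra.induction_linear (motive := p) a h0 hadd hm

/-- The conjugate-linear map sending each word to its adjoint. -/
def starAux : MonoidAlgebra ℂ (Word P) →+ MonoidAlgebra ℂ (Word P) :=
  (Finsupp.liftAddHom fun w : Word P =>
    (MonoidAlgebra.singleAddHom (R := ℂ) (Word.adj w)).comp
      (starAddEquiv (R := ℂ)).toAddMonoidHom).comp
    (MonoidAlgebra.coeffAddEquiv (R := ℂ) (M := Word P)).toAddMonoidHom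

theorem starAux_single (w : Word P) (r : ℂ) :
    starAux (MonoidAlgebra.single w r) = MonoidAlgebra.single w.adj (star r) := by
  show Finsupp.liftAddHom _ (Finsupp.single w r) = _
  rw [Finsupp.liftAddHom_apply_single]
  rfl

/-- The involution of the free ⋆-algebra, as an additive map. -/
def starHom : FreeStarAlg P →+ FreeStarAlg P := starAux

theorem starHom_mono (w : Word P) (r : ℂ) : starHom (mono w r) = mono w.adj (star r) :=
  starAux_single w r

instance : StarRing (FreeStarAlg P) where
  star := starHom
  star_involutive a := by
    induction a using induct with
    | h0 => simp
    | hadd a b ha hb => simp [ha, hb]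
    | hm w r => simp [starHom_mono, Word.adj_adj]
  star_mul a b := by
    show starHom (a * b) = starHom b * starHom a
    induction a using induct with
    | h0 => simp
    | hadd a a' ha ha' => simp [add_mul, mul_add, ha, ha']
    | hm w r =>
      induction b using induct with
      | h0 => simp
      | hadd a b ha hb => simp [add_mul, mul_add, ha, hb]
      | hm v s => simp [starHom_mono, mono_mul, Word.adj_mul, mul_comm]
  star_add a b := map_add starHom a b

theorem star_mono (w : Word P) (r : ℂ) : star (mono w r) = mono w.adj (star r) := starHom_mono w r

instance : StarModule ℂ (FreeStarAlg P) where
  star_smul c a := by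
    induction a using induct with
    | h0 => simp
    | hadd a b ha hb => simp [ha, hb]
    | hm w r => simp [star_mono, smul_mono]

end FreeStarAlg

namespace NicaRep

variable {P : Submonoid G} {B : Type u} [CStarAlgebra B] (V : NicaRep P B)

/-- The value of a word: `v_x ↦ V_x` and `v_x⋆ ↦ V_x⋆`. -/
def word : Word P →* B :=
  FreeMonoid.lift fun l => if l.2 then star (V.toHom l.1) else V.toHom l.1

theorem word_adj (w : Word P) : V.word w.adj = star (V.word w) := by
  induction w using FreeMonoid.recOn with
  | one => simp [Word.adj_one]
  | of_mul l w ih =>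
    rw [Word.adj_mul, map_mul, map_mul, ih, star_mul, Word.adj_of]
    rcases l with ⟨x, _ | _⟩ <;> simp [word]

theorem norm_toHom_le (x : P) : ‖V.toHom x‖ ≤ 1 := by
  have h := CStarRing.norm_star_mul_self (x := V.toHom x)
  rw [V.isometry] at h
  rcases subsingleton_or_nontrivial B with hB | hB
  · rw [Subsingleton.elim (V.toHom x) 0]; simp
  · rw [CStarRing.norm_one] at h
    nlinarith [norm_nonneg (V.toHom x)]

theorem norm_word_le (w : Word P) : ‖V.word w‖ ≤ 1 := by
  induction w using FreeMonoid.recOn with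
  | one =>
    have := V.norm_toHom_le 1
    simpa using this
  | of_mul l w ih =>
    rw [map_mul]
    refine (norm_mul_le _ _).trans (mul_le_one₀ ?_ (norm_nonneg _) ih)
    rcases l with ⟨x, _ | _⟩ <;> simp [word, V.norm_toHom_le]

/-- The extension of `V` to the free ⋆-algebra. -/
def evalAlg : FreeStarAlg P →ₐ[ℂ] B := MonoidAlgebra.lift ℂ B (Word P) V.word

theorem evalAlg_mono (w : Word P) (r : ℂ) : V.evalAlg (FreeStarAlg.mono w r) = r • V.word w :=
  MonoidAlgebra.lift_single V.word w r

/-- The ⋆-homomorphism on the free ⋆-algebra that extends `V`. -/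
def eval : FreeStarAlg P →⋆ₐ[ℂ] B where
  __ := V.evalAlg
  map_star' a := by
    show V.evalAlg (star a) = star (V.evalAlg a)
    induction a using FreeStarAlg.induct with
    | h0 => simp
    | hadd a b ha hb => simp [ha, hb]
    | hm w r => simp [FreeStarAlg.star_mono, evalAlg_mono, word_adj]

theorem eval_mono (w : Word P) (r : ℂ) : V.eval (FreeStarAlg.mono w r) = r • V.word w :=
  V.evalAlg_mono w r

end NicaRep

/-! ### The universal C⋆-algebra `C⋆(G, P)` -/

namespace FreeStarAlg

variable {P : Submonoid G}

/-- The set of norms `‖V(a)‖`, for all Nica-covariant representations `V` of `P`. -/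
def norms (a : FreeStarAlg P) : Set ℝ :=
  {r | ∃ (B : Type u) (_ : CStarAlgebra B) (V : NicaRep P B), r = ‖V.eval a‖}

theorem exists_bound (a : FreeStarAlg P) :
    ∃ C : ℝ, ∀ (B : Type u) (_ : CStarAlgebra B) (V : NicaRep P B), ‖V.eval a‖ ≤ C := by
  induction a using induct with
  | h0 => exact ⟨0, fun B _ V => by simp⟩
  | hadd a b ha hb =>
    obtain ⟨C, hC⟩ := ha
    obtain ⟨D, hD⟩ := hb
    refine ⟨C + D, fun B _ V => ?_⟩
    rw [map_add]
    exact (norm_add_le _ _).trans (add_le_add (hC B _ V) (hD B _ V))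
  | hm w r =>
    refine ⟨‖r‖, fun B _ V => ?_⟩
    rw [V.eval_mono, norm_smul]
    exact mul_le_of_le_one_right (norm_nonneg _) (V.norm_word_le w)

theorem bddAbove_norms (a : FreeStarAlg P) : BddAbove (norms a) := by
  obtain ⟨C, hC⟩ := exists_bound a
  refine ⟨C, ?_⟩
  rintro _ ⟨B, i, V, rfl⟩
  exact hC B i V

/-- The universal seminorm `‖a‖ = sup_V ‖V(a)‖`. -/
def unorm (a : FreeStarAlg P) : ℝ := sSup (norms a)

theorem le_unorm (a : FreeStarAlg P) {B : Type u} [i : CStarAlgebra B] (V : NicaRep P B) :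
    ‖V.eval a‖ ≤ unorm a :=
  le_csSup (bddAbove_norms a) ⟨B, i, V, rfl⟩

theorem unorm_le {a : FreeStarAlg P} {C : ℝ} (hC : 0 ≤ C)
    (h : ∀ (B : Type u) (_ : CStarAlgebra B) (V : NicaRep P B), ‖V.eval a‖ ≤ C) : unorm a ≤ C := by
  refine Real.sSup_le ?_ hC
  rintro _ ⟨B, i, V, rfl⟩
  exact h B i V

theorem unorm_nonneg (a : FreeStarAlg P) : 0 ≤ unorm a := by
  refine Real.sSup_nonneg ?_
  rintro _ ⟨B, i, V, rfl⟩
  exact norm_nonneg _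

/-- The universal seminorm as a ring seminorm. -/
def uRingSeminorm : RingSeminorm (FreeStarAlg P) where
  toFun := unorm
  map_zero' := le_antisymm (unorm_le le_rfl fun B _ V => by simp) (unorm_nonneg _)
  add_le' a b := unorm_le (add_nonneg (unorm_nonneg a) (unorm_nonneg b)) fun B _ V => by
    rw [map_add]
    exact (norm_add_le _ _).trans (add_le_add (le_unorm a V) (le_unorm b V))
  neg' a := by simp [unorm, norms]
  mul_le' a b := unorm_le (mul_nonneg (unorm_nonneg a) (unorm_nonneg b)) fun B _ V => by
    rw [map_mul]
    exact (norm_mul_le _ _).trans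
      (mul_le_mul (le_unorm a V) (le_unorm b V) (norm_nonneg _) (unorm_nonneg a))

instance : SeminormedRing (FreeStarAlg P) := uRingSeminorm.toSeminormedRing

theorem norm_eq (a : FreeStarAlg P) : ‖a‖ = unorm a := rfl

instance : NormedAlgebra ℂ (FreeStarAlg P) where
  norm_smul_le r a := by
    rw [norm_eq, norm_eq]
    refine unorm_le (mul_nonneg (norm_nonneg r) (unorm_nonneg a)) fun B _ V => ?_
    rw [map_smul, norm_smul]
    exact mul_le_mul_of_nonneg_left (le_unorm a V) (norm_nonneg r)

instance : NormedStarGroup (FreeStarAlg P) where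
  norm_star_le a := by
    rw [norm_eq, norm_eq]
    refine unorm_le (unorm_nonneg a) fun B _ V => ?_
    rw [map_star, norm_star]
    exact le_unorm a V

theorem norm_mul_self_le (a : FreeStarAlg P) : ‖a‖ * ‖a‖ ≤ ‖star a * a‖ := by
  have h : ‖a‖ ≤ Real.sqrt ‖star a * a‖ := by
    rw [norm_eq]
    refine unorm_le (Real.sqrt_nonneg _) fun B _ V => ?_
    refine Real.le_sqrt_of_sq_le ?_
    rw [sq, ← CStarRing.norm_star_mul_self, ← map_star, ← map_mul]
    exact le_unorm _ V
  calc ‖a‖ * ‖a‖ ≤ Real.sqrt ‖star a * a‖ * Real.sqrt ‖star a * a‖ :=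
        mul_le_mul h h (norm_nonneg _) (Real.sqrt_nonneg _)
    _ = _ := Real.mul_self_sqrt (norm_nonneg _)

end FreeStarAlg

/-- The universal C⋆-algebra `C⋆(G, P)` for Nica-covariant representations of `P`: the (Hausdorff)
completion of the free ⋆-algebra on the symbols `v_x` in the universal seminorm. -/
def CStar (P : Submonoid G) : Type u := UniformSpace.Completion (FreeStarAlg P)

namespace CStar

open UniformSpace

variable {P : Submonoid G}

instance : NormedRing (CStar P) := inferInstanceAs (NormedRing (Completion (FreeStarAlg P)))

instance : CompleteSpace (CStar P) := inferInstanceAs (CompleteSpace (Completion (FreeStarAlg P)))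

/-- The canonical map of the free ⋆-algebra to `C⋆(G, P)`. -/
def of : FreeStarAlg P →+* CStar P := Completion.coeRingHom

theorem norm_of (a : FreeStarAlg P) : ‖of a‖ = ‖a‖ := Completion.norm_coe a

theorem induct {p : CStar P → Prop} (a : CStar P) (hc : IsClosed {a | p a})
    (h : ∀ a, p (of a)) : p a :=
  Completion.induction_on a hc h

theorem continuous_of : Continuous (of : FreeStarAlg P → CStar P) :=
  Completion.continuous_coe _

instance : Algebra ℂ (CStar P) := inferInstanceAs (Algebra ℂ (Completion (FreeStarAlg P)))

instance : NormedAlgebra ℂ (CStar P) where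
  norm_smul_le r a := norm_smul_le (β := Completion (FreeStarAlg P)) r a

theorem of_smul (r : ℂ) (a : FreeStarAlg P) : of (r • a) = r • of a :=
  Completion.coe_smul r a

instance : Star (CStar P) := ⟨Completion.map (star : FreeStarAlg P → FreeStarAlg P)⟩

theorem star_of (a : FreeStarAlg P) : star (of a) = of (star a) :=
  Completion.map_coe star_isometry.uniformContinuous a

theorem continuous_star' : Continuous (star : CStar P → CStar P) := Completion.continuous_map

instance : StarRing (CStar P) where
  star_involutive a := by
    induction a using induct with
    | hc => exact isClosed_eq (continuous_star'.comp continuous_star') continuous_id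
    | h a => rw [star_of, star_of, star_star]
  star_mul a b := by
    induction a using induct with
    | hc =>
      exact isClosed_eq (continuous_star'.comp (continuous_id.mul continuous_const))
        (continuous_const.mul continuous_star')
    | h a =>
      induction b using induct with
      | hc =>
        exact isClosed_eq (continuous_star'.comp (continuous_const.mul continuous_id))
          (continuous_star'.mul continuous_const)
      | h b => rw [star_of, star_of, ← map_mul, ← map_mul, star_of, star_mul]
  star_add a b := by
    induction a using induct with
    | hc =>
      exact isClosed_eq (continuous_star'.comp (continuous_id.add continuous_const))
        (continuous_star'.add continuous_const)
    | h a =>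
      induction b using induct with
      | hc =>
        exact isClosed_eq (continuous_star'.comp (continuous_const.add continuous_id))
          (continuous_const.add continuous_star')
      | h b => rw [star_of, star_of, ← map_add, ← map_add, star_of, star_add]

instance : CStarAlgebra (CStar P) where
  norm_mul_self_le a := by
    induction a using induct with
    | hc =>
      exact isClosed_le (continuous_norm.mul continuous_norm)
        (continuous_norm.comp (continuous_star'.mul continuous_id))
    | h a =>
      rw [star_of, ← map_mul, norm_of, norm_of]
      exact FreeStarAlg.norm_mul_self_le a
  star_smul r a := by
    induction a using induct with
    | hc =>
      exact isClosed_eq (continuous_star'.comp (continuous_const_smul r))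
        (continuous_star'.const_smul (star r))
    | h a => rw [← of_smul, star_of, star_of, star_smul, of_smul]

theorem of_eq_of {a b : FreeStarAlg P}
    (h : ∀ (B : Type u) (_ : CStarAlgebra B) (V : NicaRep P B), V.eval a = V.eval b) :
    of a = of b := by
  rw [← sub_eq_zero, ← norm_eq_zero, ← map_sub, norm_of, FreeStarAlg.norm_eq]
  refine le_antisymm (FreeStarAlg.unorm_le le_rfl fun B _ V => ?_) (FreeStarAlg.unorm_nonneg _)
  rw [map_sub, h, sub_self, norm_zero]

/-- The symbol `v_x` in the free ⋆-algebra. -/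
def sym (x : P) : FreeStarAlg P := FreeStarAlg.mono (FreeMonoid.of (x, false)) 1

theorem eval_sym {B : Type u} [CStarAlgebra B] (V : NicaRep P B) (x : P) :
    V.eval (sym x) = V.toHom x := by
  rw [sym, V.eval_mono]
  simp [NicaRep.word]

/-- The universal Nica-covariant representation `i : P → C⋆(G, P)`. -/
def univ (P : Submonoid G) : NicaRep P (CStar P) where
  toHom :=
    { toFun := fun x => of (sym x)
      map_one' := by
        rw [← map_one of]
        exact of_eq_of fun B _ V => by simp [eval_sym]
      map_mul' := fun x y => by
        rw [← map_mul]
        exact of_eq_of fun B _ V => by simp [eval_sym] }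
  isometry x := by
    show star (of (sym x)) * of (sym x) = 1
    rw [← map_one of, star_of, ← map_mul]
    exact of_eq_of fun B _ V => by simp [eval_sym, map_star, V.isometry]
  cov_join x y z h := by
    show of (sym x) * star (of (sym x)) * (of (sym y) * star (of (sym y)))
      = of (sym z) * star (of (sym z))
    simp only [star_of, ← map_mul]
    exact of_eq_of fun B _ V => by simp only [map_mul, map_star, eval_sym, V.cov_join x y z h]
  cov_infty x y h := by
    show of (sym x) * star (of (sym x)) * (of (sym y) * star (of (sym y))) = 0
    rw [← map_zero of]
    simp only [star_of, ← map_mul]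
    exact of_eq_of fun B _ V => by
      simp only [map_mul, map_star, eval_sym, V.cov_infty x y h, map_zero]

/-- The canonical generator `i(x)` of `C⋆(G, P)`. -/
def i (x : P) : CStar P := (univ P).toHom x

section lift

variable {B : Type u} [CStarAlgebra B] (V : NicaRep P B)

theorem uniformContinuous_eval : UniformContinuous V.eval := by
  have h : LipschitzWith 1 V.eval :=
    AddMonoidHomClass.lipschitz_of_bound_nnnorm V.eval 1 fun a => by
      rw [one_mul]; exact FreeStarAlg.le_unorm a V
  exact h.uniformContinuous

/-- The function underlying `CStar.lift`. -/
def liftFun : CStar P → B := Completion.extension V.eval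

theorem liftFun_of (a : FreeStarAlg P) : liftFun V (of a) = V.eval a :=
  Completion.extension_coe (uniformContinuous_eval V) a

theorem continuous_liftFun : Continuous (liftFun V) := Completion.continuous_extension

/-- The universal property of `C⋆(G, P)`: a Nica-covariant representation `V` of `P` in `B`
induces the ⋆-homomorphism `π_V : C⋆(G, P) → B` with `π_V(i(x)) = V_x`. -/
def lift : CStar P →⋆ₐ[ℂ] B where
  toFun := liftFun V
  map_one' := by rw [← map_one of, liftFun_of, map_one]
  map_zero' := by rw [← map_zero of, liftFun_of, map_zero]
  map_mul' a b := by
    have hc := continuous_liftFun V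
    induction a using induct with
    | hc => exact isClosed_eq (by fun_prop) (by fun_prop)
    | h a =>
      induction b using induct with
      | hc => exact isClosed_eq (by fun_prop) (by fun_prop)
      | h b => rw [← map_mul, liftFun_of, liftFun_of, liftFun_of, map_mul]
  map_add' a b := by
    have hc := continuous_liftFun V
    induction a using induct with
    | hc => exact isClosed_eq (by fun_prop) (by fun_prop)
    | h a =>
      induction b using induct with
      | hc => exact isClosed_eq (by fun_prop) (by fun_prop)
      | h b => rw [← map_add, liftFun_of, liftFun_of, liftFun_of, map_add]
  commutes' r := by
    rw [Algebra.algebraMap_eq_smul_one, ← map_one of, ← of_smul, liftFun_of, map_smul, map_one,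
      Algebra.algebraMap_eq_smul_one]
  map_star' a := by
    have hc := continuous_liftFun V
    induction a using induct with
    | hc => exact isClosed_eq (by fun_prop) (by fun_prop)
    | h a => rw [star_of, liftFun_of, liftFun_of, map_star]

theorem lift_i (x : P) : lift V (i x) = V.toHom x :=
  (liftFun_of V (sym x)).trans (eval_sym V x)

end lift

/-- `C⋆(G, P)` is generated by the `i(x)`: a ⋆-homomorphism is determined by its values there. -/
theorem hom_ext {B : Type u} [CStarAlgebra B] {φ ψ : CStar P →⋆ₐ[ℂ] B}
    (h : ∀ x, φ (i x) = ψ (i x)) : φ = ψ := by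
  have hw : ∀ w : Word P, φ (of (FreeStarAlg.mono w 1)) = ψ (of (FreeStarAlg.mono w 1)) := by
    intro w
    induction w using FreeMonoid.recOn with
    | one => rw [← FreeStarAlg.one_eq]; simp
    | of_mul l w ih =>
      have e : (FreeStarAlg.mono (FreeMonoid.of l * w) 1 : FreeStarAlg P) =
          FreeStarAlg.mono (FreeMonoid.of l) 1 * FreeStarAlg.mono w 1 := by
        rw [FreeStarAlg.mono_mul, one_mul]
      rw [e, map_mul, map_mul, map_mul, ih]
      congr 1
      rcases l with ⟨x, _ | _⟩
      · exact h x
      · have e' : (FreeStarAlg.mono (FreeMonoid.of (x, true)) 1 : FreeStarAlg P) = star (sym x) := by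
          rw [sym, FreeStarAlg.star_mono, Word.adj_of]; simp
        rw [e', ← star_of, map_star, map_star]
        exact congrArg star (h x)
  refine StarAlgHom.ext fun a => ?_
  have hφ : Continuous φ := by
    open scoped CStarAlgebra in exact map_continuous φ
  have hψ : Continuous ψ := by
    open scoped CStarAlgebra in exact map_continuous ψ
  induction a using induct with
  | hc => exact isClosed_eq hφ hψ
  | h a =>
    induction a using FreeStarAlg.induct with
    | h0 => simp
    | hadd a b ha hb => simp [ha, hb]
    | hm w r =>
      have e : FreeStarAlg.mono w r = r • FreeStarAlg.mono w 1 := by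
        rw [FreeStarAlg.smul_mono, mul_one]
      rw [e, of_smul, map_smul, map_smul, hw]

end CStar

/-! ### The Toeplitz algebra -/

section Toeplitz

/-- The Hilbert space `ℓ²(P)`. -/
abbrev ell2 (P : Submonoid G) : Type u := lp (fun _ : P => ℂ) 2

open Classical in
/-- The point mass `e_x` in `ℓ²(P)`. -/
def e {P : Submonoid G} (x : P) : ell2 P := lp.single 2 x (1 : ℂ)

theorem inner_e {P : Submonoid G} (x : P) (f : ell2 P) : inner ℂ (e x) f = f x := by
  classical
  rw [e, lp.inner_single_left]; simp

theorem e_apply {P : Submonoid G} (x y : P) [Decidable (x = y)] :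
    (e y : ell2 P) x = if x = y then 1 else 0 := by
  classical
  rw [e, lp.single_apply, Pi.single_apply]
  congr

theorem orthonormal_e {P : Submonoid G} : Orthonormal ℂ (e : P → ell2 P) := by
  classical
  rw [orthonormal_iff_ite]
  intro x y
  rw [inner_e, e_apply]

theorem orthogonal_e_mul {P : Submonoid G} (x : P) :
    OrthogonalFamily ℂ (fun _ : P => ℂ)
      (fun y => LinearIsometry.toSpanSingleton ℂ (ell2 P) (orthonormal_e.1 (x * y))) :=
  (orthonormal_e.comp (fun y : P => x * y) (mul_right_injective x)).orthogonalFamily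

/-- The isometry `T_x` on `ℓ²(P)`, with `T_x e_y = e_{xy}`. -/
def T {P : Submonoid G} (x : P) : ell2 P →L[ℂ] ell2 P :=
  (orthogonal_e_mul x).linearIsometry.toContinuousLinearMap

theorem T_e {P : Submonoid G} (x y : P) : T x (e y) = e (x * y) := by
  classical
  show (orthogonal_e_mul x).linearIsometry (e y) = _
  rw [e, OrthogonalFamily.linearIsometry_apply_single]
  simp

theorem T_apply_mul {P : Submonoid G} (x y : P) (f : ell2 P) : T x f (x * y) = f y := by
  rw [← inner_e, ← T_e]
  show inner ℂ ((orthogonal_e_mul x).linearIsometry (e y)) ((orthogonal_e_mul x).linearIsometry f)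
    = _
  rw [LinearIsometry.inner_map_map, inner_e]

theorem star_T_apply {P : Submonoid G} (x y : P) (f : ell2 P) : star (T x) f y = f (x * y) := by
  rw [← inner_e, ContinuousLinearMap.star_eq_adjoint, ContinuousLinearMap.adjoint_inner_right,
    T_e, inner_e]

theorem T_apply_eq_zero {P : Submonoid G} (x z : P) (h : ¬ PLe P (x : G) z) (f : ell2 P) :
    T x f z = 0 := by
  classical
  have h0 : star (T x) (e z) = 0 := by
    ext y
    rw [star_T_apply, e_apply, if_neg]
    · rfl
    · rintro rfl
      exact h (by simp [PLe])
  rw [← inner_e, ← ContinuousLinearMap.adjoint_inner_left, ← ContinuousLinearMap.star_eq_adjoint,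
    h0, inner_zero_left]

open Classical in
theorem T_mul_star_T_apply {P : Submonoid G} (x z : P) (f : ell2 P) :
    (T x * star (T x)) f z = if PLe P (x : G) z then f z else 0 := by
  rw [mul_apply_eq_comp]
  split_ifs with h
  · obtain ⟨y, rfl⟩ : ∃ y : P, z = x * y := ⟨⟨_, h⟩, Subtype.ext (by simp)⟩
    rw [T_apply_mul, star_T_apply]
  · exact T_apply_eq_zero x z h _

/-- The Toeplitz algebra `𝒯(P)`: the C⋆-subalgebra of `B(ℓ²(P))` generated by the `T_x`. -/
def ToeplitzAlgebra (P : Submonoid G) : StarSubalgebra ℂ (ell2 P →L[ℂ] ell2 P) :=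
  (StarAlgebra.adjoin ℂ (Set.range (T : P → ell2 P →L[ℂ] ell2 P))).topologicalClosure

instance (P : Submonoid G) : CStarAlgebra (ToeplitzAlgebra P) :=
  StarSubalgebra.cstarAlgebra (ToeplitzAlgebra P)
    (h_closed := StarSubalgebra.isClosed_topologicalClosure _)

theorem T_mem {P : Submonoid G} (x : P) : T x ∈ ToeplitzAlgebra P :=
  StarSubalgebra.le_topologicalClosure _ (StarAlgebra.subset_adjoin ℂ _ ⟨x, rfl⟩)

theorem PLe.trans' {P : Submonoid G} {g h k : G} (h₁ : PLe P g h) (h₂ : PLe P h k) : PLe P g k := by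
  have := P.mul_mem h₁ h₂
  simpa [PLe, mul_assoc] using this

/-- The Toeplitz representation `x ↦ T_x`, as a Nica-covariant representation in `𝒯(P)`. -/
def toeplitzRep (P : Submonoid G) : NicaRep P (ToeplitzAlgebra P) where
  toHom :=
    { toFun := fun x => ⟨T x, T_mem x⟩
      map_one' := by
        refine Subtype.ext (ContinuousLinearMap.ext fun f => ?_)
        ext z
        have := T_apply_mul 1 z f
        simpa using this
      map_mul' := fun x y => by
        classical
        refine Subtype.ext ?_
        show T (x * y) = T x * T y
        rw [← star_inj, star_mul]
        refine ContinuousLinearMap.ext fun f => ?_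
        ext z
        rw [mul_apply_eq_comp]
        simp only [star_T_apply, mul_assoc] }
  isometry x := by
    refine Subtype.ext ?_
    show star (T x) * T x = 1
    refine ContinuousLinearMap.ext fun f => ?_
    ext z
    rw [mul_apply_eq_comp, star_T_apply, T_apply_mul]
    rfl
  cov_join x y z h := by
    classical
    refine Subtype.ext ?_
    show T x * star (T x) * (T y * star (T y)) = T z * star (T z)
    refine ContinuousLinearMap.ext fun f => ?_
    ext w
    rw [mul_apply_eq_comp, T_mul_star_T_apply, T_mul_star_T_apply, T_mul_star_T_apply]
    by_cases hz : PLe P (z : G) w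
    · rw [if_pos hz, if_pos (PLe.trans' h.1.2.1 hz), if_pos (PLe.trans' h.1.2.2 hz)]
    · rw [if_neg hz]
      split_ifs with hx hy
      · exact absurd (h.2 w ⟨w.2, hx, hy⟩) hz
      · rfl
      · rfl
  cov_infty x y h := by
    classical
    refine Subtype.ext ?_
    show T x * star (T x) * (T y * star (T y)) = 0
    refine ContinuousLinearMap.ext fun f => ?_
    ext w
    rw [mul_apply_eq_comp, T_mul_star_T_apply, T_mul_star_T_apply]
    split_ifs with hx hy
    · exact absurd ⟨(w : G), w.2, hx, hy⟩ h
    · rfl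
    · rfl

/-- The Toeplitz representation `π_T : C⋆(G, P) → 𝒯(P)`, with `π_T(i(x)) = T_x`. -/
def piT (P : Submonoid G) : CStar P →⋆ₐ[ℂ] ToeplitzAlgebra P := CStar.lift (toeplitzRep P)

end Toeplitz

/-! ### Amenability -/

/-- The closed linear span of the range projections `i(x) i(x)⋆` in `C⋆(G, P)`. -/
def diagonal (P : Submonoid G) : Submodule ℂ (CStar P) :=
  (Submodule.span ℂ (Set.range fun x : P => CStar.i x * star (CStar.i x))).topologicalClosure

/-- `Φ` is the diagonal expectation: the linear contraction of `C⋆(G, P)` into the closed span of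
the `i(x) i(x)⋆` that fixes each `i(x) i(x)⋆` and kills `i(x) i(y)⋆` for `x ≠ y`. -/
structure IsDiagonalExpectation (P : Submonoid G) (Φ : CStar P →L[ℂ] diagonal P) : Prop where
  norm_le : ‖Φ‖ ≤ 1
  apply_same : ∀ x : P,
    (Φ (CStar.i x * star (CStar.i x)) : CStar P) = CStar.i x * star (CStar.i x)
  apply_ne : ∀ x y : P, x ≠ y → Φ (CStar.i x * star (CStar.i y)) = 0

/-- `(G, P)` is amenable: it is quasi-lattice ordered and the diagonal expectation (which is unique,
as `C⋆(G, P)` is then the closed span of the `i(x) i(y)⋆`) exists and is faithful. -/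
structure IsAmenable (P : Submonoid G) : Prop where
  quasiLattice : IsQuasiLatticeOrdered P
  faithful : ∃ Φ : CStar P →L[ℂ] diagonal P, IsDiagonalExpectation P Φ ∧
    ∀ R : CStar P, Φ (star R * R) = 0 → R = 0

end QuasiLattice

/-! ### Baumslag-Solitar groups -/

namespace BaumslagSolitar

/-- The generators `a` and `b`. -/
inductive Gen : Type
  | a
  | b

/-- The relator of `a b^c = b^d a`. -/
def rel (c d : ℕ) : FreeGroup Gen :=
  FreeGroup.of Gen.a * FreeGroup.of Gen.b ^ c * (FreeGroup.of Gen.b ^ d * FreeGroup.of Gen.a)⁻¹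

/-- The group `BS(c, d) = ⟨a, b : a b^c = b^d a⟩`. -/
abbrev BS (c d : ℕ) : Type := PresentedGroup {rel c d}

/-- The submonoid `P` of `BS(c, d)` generated by `a` and `b`. -/
def P (c d : ℕ) : Submonoid (BS c d) :=
  Submonoid.closure {PresentedGroup.of Gen.a, PresentedGroup.of Gen.b}

end BaumslagSolitar

end

noncomputable section

namespace QuasiLattice

open Filter Topology

variable {G : Type u} [Group G] {P : Submonoid G}

/-! ### The spanning elements `i x * star (i y)` of C⋆(G, P) -/

namespace CStar

/-! Faithfulness of π_T is proved first, and amenability is deduced from it. An injective π_T is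
isometric, and the diagonal of C⋆(G, P) acts on ℓ²(P) by multiplication operators, so the diagonal
embeds isometrically in ℓ^∞(P). Taking the diagonal matrix entries of π_T(a) and pulling them back
along this embedding gives Φ. It is faithful because the diagonal entries of π_T(a⋆a) are the
numbers ‖π_T(a) e_x‖² (`isAmenable_of_injective`).

For faithfulness, grade P by the number of letters a (the height). The average over the resulting
circle action is faithful, preserves the kernel of π_T and takes values in the core, the closed span
of the i(x) i(y)⋆ with x, y of equal height. So it suffices that π_T is isometric on the core
(`piT_injective_of_levelBound`). The level n part of the core kills vectors supported in heights
below n, so lower bounds on the single levels (`LevelBound`) combine triangularly to ‖a‖ ≤ C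
‖π_T(a)‖ on the part of height at most k. That part is a ⋆-algebra, as joins do not exceed the
larger height, and the bound for the powers of a⋆a removes C (`norm_opT_of_mem_coreUpTo`).

In BS(c, d), an element of height k is σ b^n with σ one of the d^k stems b^{s₁} a ⋯ b^{s_k} a, 0 ≤
s_j < d, and distinct stems of equal length have no common upper bound. Level k thus consists of
matrices over the image of the universal algebra of one isometry, and the entries are controlled by
the faithful Toeplitz representation of ℕ (`levelBound_of_stems`). The latter is the same argument
for the powers of b, where each level has dimension at most one (`piT_powers_injective`).

Normal forms and joins come from Britton's lemma for BS(c, d) as an HNN extension of ℤ. Joins are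
found first in the cone P⟨b⟩, where powers of b are invertible (`exists_cone_inter`), and then
corrected by a power of b (`exists_inter`). -/

theorem i_mul (x y : P) : i (x * y) = i x * i y := map_mul (univ P).toHom x y

theorem i_one : i (1 : P) = 1 := map_one (univ P).toHom

theorem star_i_mul_self (x : P) : star (i x) * i x = 1 := (univ P).isometry x

theorem norm_i_le (x : P) : ‖i x‖ ≤ 1 := (univ P).norm_toHom_le x

/-- Insert the isometry relations to expose the two range projections between `star (i x)` and `i
y`; covariance replaces their product by the range projection of the join, and the outer factors
cancel. -/
theorem star_i_mul_i_of_join {x y u v : P} (h : IsJoin P (x : G) y (x * u : P))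
    (hv : x * u = y * v) : star (i x) * i y = i u * star (i v) := by
  have h1 := (univ P).cov_join x y (x * u) h
  change i x * star (i x) * (i y * star (i y)) = i (x * u) * star (i (x * u)) at h1
  have h2 : star (i (x * u)) = star (i v) * star (i y) := by rw [hv, i_mul, star_mul]
  calc star (i x) * i y
      = star (i x) * i x * star (i x) * i y * (star (i y) * i y) := by
        rw [star_i_mul_self, star_i_mul_self, one_mul, mul_one]
    _ = star (i x) * (i x * star (i x) * (i y * star (i y))) * i y := by
        simp only [mul_assoc]
    _ = (star (i x) * i x) * i u * star (i v) * (star (i y) * i y) := by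
        rw [h1, h2, i_mul]; simp only [mul_assoc]
    _ = i u * star (i v) := by rw [star_i_mul_self, star_i_mul_self, one_mul, mul_one]

theorem star_i_mul_i_of_not_upper {x y : P} (h : ¬ ∃ w, IsUpper P (x : G) y w) :
    star (i x) * i y = 0 := by
  have h1 := (univ P).cov_infty x y h
  change i x * star (i x) * (i y * star (i y)) = 0 at h1
  calc star (i x) * i y
      = star (i x) * i x * star (i x) * i y * (star (i y) * i y) := by
        rw [star_i_mul_self, star_i_mul_self, one_mul, mul_one]
    _ = star (i x) * (i x * star (i x) * (i y * star (i y))) * i y := by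
        simp only [mul_assoc]
    _ = 0 := by rw [h1, mul_zero, zero_mul]

/-- This moves all adjoints to the right, so that products of spanning elements are again spanning
elements or zero. -/
theorem star_i_mul_i (hP : IsQuasiLatticeOrdered P) (x y : P) :
    star (i x) * i y = 0 ∨ ∃ u v : P, x * u = y * v ∧ IsJoin P (x : G) y (x * u : P) ∧
      star (i x) * i y = i u * star (i v) := by
  by_cases h : ∃ w, IsUpper P (x : G) y w
  · obtain ⟨z, hz⟩ := hP.exists_join _ _ h
    right
    have e1 : (x : G) * ((x : G)⁻¹ * z) = z := mul_inv_cancel_left _ _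
    have e2 : (y : G) * ((y : G)⁻¹ * z) = z := mul_inv_cancel_left _ _
    have hv : x * ⟨_, hz.1.2.1⟩ = y * ⟨_, hz.1.2.2⟩ := Subtype.ext (e1.trans e2.symm)
    have hz' : IsJoin P (x : G) y (x * ⟨_, hz.1.2.1⟩ : P) := by
      show IsJoin P (x : G) y ((x : G) * ((x : G)⁻¹ * z))
      rwa [e1]
    exact ⟨_, _, hv, hz', star_i_mul_i_of_join hz' hv⟩
  · exact Or.inl (star_i_mul_i_of_not_upper h)

/-- The linear span of the elements `i(x) i(y)⋆` with `(x, y)` in a given relation. -/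
def spanOn (r : P → P → Prop) : Submodule ℂ (CStar P) :=
  Submodule.span ℂ {a | ∃ x y, r x y ∧ a = i x * star (i y)}

theorem mem_spanOn {r : P → P → Prop} {x y : P} (h : r x y) : i x * star (i y) ∈ spanOn r :=
  Submodule.subset_span ⟨x, y, h, rfl⟩

theorem spanOn_induction {r : P → P → Prop} {p : CStar P → Prop}
    (h0 : p 0) (hadd : ∀ a b, p a → p b → p (a + b)) (hsmul : ∀ (c : ℂ) a, p a → p (c • a))
    (hr : ∀ x y, r x y → p (i x * star (i y))) {a : CStar P} (ha : a ∈ spanOn r) : p a := by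
  induction ha using Submodule.span_induction with
  | mem a h => obtain ⟨x, y, h, rfl⟩ := h; exact hr x y h
  | zero => exact h0
  | add a b _ _ ha hb => exact hadd a b ha hb
  | smul c a _ ha => exact hsmul c a ha

theorem spanOn_mono {r s : P → P → Prop} (h : ∀ x y, r x y → s x y) :
    spanOn r ≤ spanOn s :=
  Submodule.span_mono (by rintro _ ⟨x, y, hr, rfl⟩; exact ⟨x, y, h x y hr, rfl⟩)

theorem star_mem_spanOn {r : P → P → Prop} (hr : ∀ x y, r x y → r y x) {a : CStar P}
    (ha : a ∈ spanOn r) : star a ∈ spanOn r := by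
  refine spanOn_induction (p := fun a => star a ∈ spanOn r) ?_ ?_ ?_ ?_ ha
  · simp
  · intro a b ha hb; rw [star_add]; exact add_mem ha hb
  · intro c a ha; rw [star_smul]; exact Submodule.smul_mem _ _ ha
  · intro x y h; rw [star_mul, star_star]; exact mem_spanOn (hr x y h)

/-- A nonzero product of i(x) i(y)⋆ and i(z) i(w)⋆ is i(xu) i(wv)⋆ with yu = zv the join of y and z,
so only stability of `r` under this operation matters. -/
theorem mul_mem_spanOn (hP : IsQuasiLatticeOrdered P) {r : P → P → Prop}
    (hr : ∀ x y z w u v, r x y → r z w → y * u = z * v → IsJoin P (y : G) z (y * u : P) →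
      r (x * u) (w * v)) {a b : CStar P} (ha : a ∈ spanOn r) (hb : b ∈ spanOn r) :
    a * b ∈ spanOn r := by
  refine spanOn_induction (p := fun a => a * b ∈ spanOn r) ?_ ?_ ?_ ?_ ha
  · simp
  · intro a b ha hb; rw [add_mul]; exact add_mem ha hb
  · intro c a ha; rw [smul_mul_assoc]; exact Submodule.smul_mem _ _ ha
  intro x y hxy
  refine spanOn_induction (p := fun b => i x * star (i y) * b ∈ spanOn r) ?_ ?_ ?_ ?_ hb
  · simp
  · intro a b ha hb; rw [mul_add]; exact add_mem ha hb
  · intro c a ha; rw [mul_smul_comm]; exact Submodule.smul_mem _ _ ha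
  intro z w hzw
  have e : i x * star (i y) * (i z * star (i w)) = i x * (star (i y) * i z) * star (i w) := by
    simp only [mul_assoc]
  rw [e]
  rcases star_i_mul_i hP y z with h | ⟨u, v, huv, hj, h⟩
  · rw [h]; simp
  · rw [h]
    have e : i x * (i u * star (i v)) * star (i w) = i (x * u) * star (i (w * v)) := by
      rw [i_mul, i_mul, star_mul]; simp only [mul_assoc]
    rw [e]
    exact mem_spanOn (hr x y z w u v hxy hzw huv hj)

theorem of_mem_spanOn (hP : IsQuasiLatticeOrdered P) (a : FreeStarAlg P) :
    of a ∈ spanOn (fun _ _ : P => True) := by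
  induction a using FreeStarAlg.induct with
  | h0 => simp
  | hadd a b ha hb => rw [map_add]; exact add_mem ha hb
  | hm w r =>
    have e : FreeStarAlg.mono w r = r • FreeStarAlg.mono w 1 := by
      rw [FreeStarAlg.smul_mono, mul_one]
    rw [e, of_smul]
    refine Submodule.smul_mem _ _ ?_
    induction w using FreeMonoid.recOn with
    | one =>
      rw [← FreeStarAlg.one_eq, map_one]
      have := mem_spanOn (r := fun _ _ : P => True) (x := 1) (y := 1) trivial
      simpa [i_one] using this
    | of_mul l w ih =>
      have e : (FreeStarAlg.mono (FreeMonoid.of l * w) 1 : FreeStarAlg P) =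
          FreeStarAlg.mono (FreeMonoid.of l) 1 * FreeStarAlg.mono w 1 := by
        rw [FreeStarAlg.mono_mul, one_mul]
      rw [e, map_mul]
      refine mul_mem_spanOn hP (fun _ _ _ _ _ _ _ _ _ _ => trivial) ?_ (ih (by
        rw [FreeStarAlg.smul_mono, mul_one]))
      rcases l with ⟨x, _ | _⟩
      · have := mem_spanOn (r := fun _ _ : P => True) (x := x) (y := 1) trivial
        rwa [i_one, star_one, mul_one] at this
      · have e' : (FreeStarAlg.mono (FreeMonoid.of (x, true)) 1 : FreeStarAlg P) =
            star (sym x) := by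
          rw [sym, FreeStarAlg.star_mono, Word.adj_of]; simp
        rw [e', ← star_of]
        have := mem_spanOn (r := fun _ _ : P => True) (x := 1) (y := x) trivial
        rwa [i_one, one_mul] at this

/-- To prove a closed linear condition on `C⋆(G, P)` it suffices to treat `i(x) i(y)⋆`. -/
theorem dense_induction (hP : IsQuasiLatticeOrdered P) {p : CStar P → Prop}
    (hc : IsClosed {a | p a}) (h0 : p 0) (hadd : ∀ a b, p a → p b → p (a + b))
    (hsmul : ∀ (c : ℂ) a, p a → p (c • a)) (hr : ∀ x y, p (i x * star (i y))) (a : CStar P) :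
    p a := by
  induction a using induct with
  | hc => exact hc
  | h a =>
    exact spanOn_induction h0 hadd hsmul (fun x y _ => hr x y) (of_mem_spanOn hP a)

end CStar

/-! ### Matrix coefficients of the Toeplitz representation -/

/-- The operator `π_T(a)` on `ℓ²(P)`. -/
def opT (a : CStar P) : ell2 P →L[ℂ] ell2 P := (piT P a : ell2 P →L[ℂ] ell2 P)

@[simp] theorem opT_zero : opT (0 : CStar P) = 0 := by simp [opT]

theorem opT_add (a b : CStar P) : opT (a + b) = opT a + opT b := by simp [opT]

theorem opT_smul (c : ℂ) (a : CStar P) : opT (c • a) = c • opT a := by simp [opT]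

theorem opT_mul (a b : CStar P) : opT (a * b) = opT a * opT b := by simp [opT]

theorem opT_star (a : CStar P) : opT (star a) = star (opT a) := by rw [opT, map_star]; rfl

theorem opT_i (x : P) : opT (CStar.i x) = T x := by
  rw [opT, piT, CStar.lift_i]
  rfl

theorem norm_opT (a : CStar P) : ‖opT a‖ = ‖piT P a‖ := rfl

theorem norm_piT_le (a : CStar P) : ‖piT P a‖ ≤ ‖a‖ := by
  open scoped CStarAlgebra in exact NonUnitalStarAlgHom.norm_apply_le (piT P) a

theorem continuous_opT : Continuous (opT : CStar P → _) := by
  have : Continuous (piT P) := by open scoped CStarAlgebra in exact map_continuous (piT P)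
  exact continuous_subtype_val.comp this

theorem piT_eq_zero_iff {a : CStar P} : piT P a = 0 ↔ opT a = 0 := by
  simp [opT]

theorem continuous_coord (x : P) : Continuous fun f : ell2 P => f x := by
  have : (fun f : ell2 P => f x) = fun f => inner ℂ (e x) f := by
    funext f; rw [inner_e]
  rw [this]
  fun_prop

theorem continuous_opT_apply (f : ell2 P) (x : P) : Continuous fun a : CStar P => opT a f x :=
  (continuous_coord x).comp (continuous_opT.clm_apply continuous_const)

theorem eq_zero_of_apply_e {A : ell2 P →L[ℂ] ell2 P} (h : ∀ x, A (e x) = 0) : A = 0 := by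
  rw [← star_eq_zero]
  ext f x
  rw [← inner_e, ContinuousLinearMap.star_eq_adjoint, ContinuousLinearMap.adjoint_inner_right, h]
  simp

theorem norm_e (x : P) : ‖(e x : ell2 P)‖ = 1 := orthonormal_e.1 x

theorem norm_apply_le (f : ell2 P) (x : P) : ‖f x‖ ≤ ‖f‖ :=
  lp.norm_apply_le_norm (by norm_num) f x

theorem opT_i_mul_star_apply_mul (x y w : P) (f : ell2 P) :
    opT (CStar.i x * star (CStar.i y)) f (x * w) = f (y * w) := by
  rw [opT_mul, opT_star, opT_i, opT_i, mul_apply_eq_comp, T_apply_mul, star_T_apply]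

theorem opT_i_mul_star_apply_of_not_le (x y : P) {z : P} (h : ¬ PLe P (x : G) z) (f : ell2 P) :
    opT (CStar.i x * star (CStar.i y)) f z = 0 := by
  rw [opT_mul, opT_i, mul_apply_eq_comp]
  exact T_apply_eq_zero x z h _

theorem PLe.exists_eq_mul {x z : P} (h : PLe P (x : G) z) : ∃ w : P, z = x * w :=
  ⟨⟨_, h⟩, Subtype.ext (by simp)⟩

end QuasiLattice

namespace QuasiLattice

variable {G : Type u} [Group G] {P : Submonoid G}

/-! ### Amenability from faithfulness of the Toeplitz representation -/

/-- The diagonal matrix coefficients of `π_T(a)`, as a bounded function on `P`. -/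
def diagCoeff (P : Submonoid G) : CStar P →L[ℂ] lp (fun _ : P => ℂ) ⊤ :=
  LinearMap.mkContinuous
    { toFun := fun a => ⟨fun x => opT a (e x) x, by
        refine memℓp_infty ⟨‖a‖, ?_⟩
        rintro _ ⟨x, rfl⟩
        exact (norm_apply_le _ x).trans ((opT a).unit_le_opNorm _ (norm_e x).le |>.trans
          (norm_piT_le a))⟩
      map_add' := fun a b => by ext x; simp [opT_add]; rfl
      map_smul' := fun c a => by ext x; simp [opT_smul] } 1 (fun a => by
        rw [one_mul]
        refine lp.norm_le_of_forall_le (norm_nonneg a) fun x => ?_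
        exact (norm_apply_le _ x).trans ((opT a).unit_le_opNorm _ (norm_e x).le |>.trans
          (norm_piT_le a)))

theorem diagCoeff_apply (a : CStar P) (x : P) : diagCoeff P a x = opT a (e x) x := rfl

theorem norm_diagCoeff_le (a : CStar P) : ‖diagCoeff P a‖ ≤ ‖a‖ :=
  ((diagCoeff P).le_opNorm a).trans
    (mul_le_of_le_one_left (norm_nonneg a) (LinearMap.mkContinuous_norm_le _ zero_le_one _))

theorem diagonal_induction {p : CStar P → Prop} (hc : IsClosed {a | p a}) (h0 : p 0)
    (hadd : ∀ a b, p a → p b → p (a + b)) (hsmul : ∀ (c : ℂ) a, p a → p (c • a))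
    (hr : ∀ x, p (CStar.i x * star (CStar.i x))) {a : CStar P} (ha : a ∈ diagonal P) : p a := by
  let S : Submodule ℂ (CStar P) :=
    { carrier := {a | p a}
      zero_mem' := h0
      add_mem' := fun {a b} ha hb => hadd a b ha hb
      smul_mem' := fun c a ha => hsmul c a ha }
  have : diagonal P ≤ S := by
    refine Submodule.topologicalClosure_minimal _ (Submodule.span_le.2 ?_) hc
    rintro _ ⟨x, rfl⟩
    exact hr x
  exact this ha

/-- Each T_x T_x⋆ is multiplication by the indicator of xP; the condition of being a multiplication
operator is linear and closed. -/
theorem opT_apply_of_mem_diagonal {a : CStar P} (ha : a ∈ diagonal P) (f : ell2 P) (z : P) :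
    opT a f z = diagCoeff P a z * f z := by
  classical
  refine diagonal_induction (p := fun a => opT a f z = diagCoeff P a z * f z)
    ?_ ?_ ?_ ?_ ?_ ha
  · refine isClosed_eq (continuous_opT_apply f z) ?_
    simp only [diagCoeff_apply]
    exact (continuous_opT_apply _ z).mul continuous_const
  · simp
  · intro a b ha hb
    simp only [diagCoeff_apply] at *
    simp [opT_add, ha, hb, add_mul]
  · intro c a ha
    simp only [diagCoeff_apply] at *
    simp [opT_smul, ha, mul_assoc]
  · intro x
    rw [diagCoeff_apply, opT_mul, opT_star, opT_i, T_mul_star_T_apply, T_mul_star_T_apply, e_apply,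
      if_pos rfl]
    split_ifs <;> simp

theorem norm_opT_le_diagCoeff {a : CStar P} (ha : a ∈ diagonal P) :
    ‖opT a‖ ≤ ‖diagCoeff P a‖ := by
  refine ContinuousLinearMap.opNorm_le_bound _ (norm_nonneg _) fun f => ?_
  have h : ∀ z, ‖opT a f z‖ ≤ ‖diagCoeff P a‖ * ‖f z‖ := fun z => by
    rw [opT_apply_of_mem_diagonal ha, norm_mul]
    exact mul_le_mul_of_nonneg_right (lp.norm_apply_le_norm (by simp) _ z) (norm_nonneg _)
  have h2 : (0 : ℝ) < (2 : ENNReal).toReal := by norm_num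
  refine lp.norm_le_of_forall_sum_le h2 (by positivity) fun s => ?_
  calc ∑ z ∈ s, ‖opT a f z‖ ^ (2 : ENNReal).toReal
      ≤ ∑ z ∈ s, (‖diagCoeff P a‖ * ‖f z‖) ^ (2 : ENNReal).toReal :=
        Finset.sum_le_sum fun z _ => Real.rpow_le_rpow (norm_nonneg _) (h z) h2.le
    _ = ‖diagCoeff P a‖ ^ (2 : ENNReal).toReal * ∑ z ∈ s, ‖f z‖ ^ (2 : ENNReal).toReal := by
        rw [Finset.mul_sum]
        exact Finset.sum_congr rfl fun z _ => Real.mul_rpow (norm_nonneg _) (norm_nonneg _)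
    _ ≤ ‖diagCoeff P a‖ ^ (2 : ENNReal).toReal * ‖f‖ ^ (2 : ENNReal).toReal :=
        mul_le_mul_of_nonneg_left (lp.sum_rpow_le_norm_rpow h2 f s) (by positivity)
    _ = _ := (Real.mul_rpow (norm_nonneg _) (norm_nonneg _)).symm

/-- The only entries of T_x T_y⋆ lie at (xw, yw), which is off the diagonal by cancellation. -/
theorem diagCoeff_i_mul_star_of_ne {x y : P} (h : x ≠ y) :
    diagCoeff P (CStar.i x * star (CStar.i y)) = 0 := by
  classical
  ext z
  rw [diagCoeff_apply]
  by_cases hz : PLe P (x : G) z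
  · obtain ⟨w, rfl⟩ := hz.exists_eq_mul
    rw [opT_i_mul_star_apply_mul, e_apply, if_neg (fun e => h (mul_right_cancel e).symm)]
    rfl
  · rw [opT_i_mul_star_apply_of_not_le x y hz]; rfl

theorem norm_piT_of_injective (hT : Function.Injective (piT P)) (a : CStar P) :
    ‖opT a‖ = ‖a‖ := by
  open scoped CStarAlgebra in exact NonUnitalStarAlgHom.norm_map (piT P) hT a

/-- If `π_T` is faithful, the diagonal of `C⋆(G, P)` embeds isometrically in `ℓ^∞(P)`. -/
def diagIsometry (hT : Function.Injective (piT P)) :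
    diagonal P →ₗᵢ[ℂ] lp (fun _ : P => ℂ) ⊤ where
  toLinearMap := (diagCoeff P).toLinearMap.comp (diagonal P).subtype
  norm_map' a := le_antisymm (norm_diagCoeff_le (a : CStar P))
    ((norm_piT_of_injective hT (a : CStar P)).symm.le.trans (norm_opT_le_diagCoeff a.2))

/-- The range of an isometry from a complete space is closed, so it suffices to look at spanning
elements, whose diagonal entries come from the diagonal or vanish. -/
theorem diagCoeff_mem_range (hP : IsQuasiLatticeOrdered P) (hT : Function.Injective (piT P))
    (a : CStar P) : diagCoeff P a ∈ LinearMap.range (diagIsometry hT).toLinearMap := by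
  classical
  have hcomp : CompleteSpace (diagonal P) :=
    (Submodule.isClosed_topologicalClosure _).completeSpace_coe
  refine CStar.dense_induction hP
    (p := fun a => diagCoeff P a ∈ LinearMap.range (diagIsometry hT).toLinearMap) ?_ ?_ ?_ ?_ ?_ a
  · have : IsClosed (Set.range (diagIsometry hT)) :=
      (diagIsometry hT).isometry.isClosedEmbedding.isClosed_range
    exact this.preimage (diagCoeff P).continuous
  · rw [map_zero]; exact zero_mem _
  · intro a b ha hb; rw [map_add]; exact add_mem ha hb
  · intro c a ha; rw [map_smul]; exact Submodule.smul_mem _ _ ha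
  · intro x y
    by_cases h : x = y
    · subst h
      exact ⟨⟨_, Submodule.le_topologicalClosure _ (Submodule.subset_span ⟨x, rfl⟩)⟩, rfl⟩
    · rw [diagCoeff_i_mul_star_of_ne h]; exact zero_mem _

/-- The diagonal entry of π_T(a⋆a) at x is ‖π_T(a) e_x‖². -/
theorem opT_eq_zero_of_diagCoeff {a : CStar P} (h : diagCoeff P (star a * a) = 0) : opT a = 0 := by
  refine eq_zero_of_apply_e fun x => ?_
  have h1 : opT (star a * a) (e x) x = 0 := by rw [← diagCoeff_apply, h]; rfl
  rw [← inner_e, opT_mul, opT_star, mul_apply_eq_comp, ContinuousLinearMap.star_eq_adjoint,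
    ContinuousLinearMap.adjoint_inner_right] at h1
  exact inner_self_eq_zero.1 h1

/-- A quasi-lattice ordered group with faithful Toeplitz representation is amenable. -/
theorem isAmenable_of_injective (hP : IsQuasiLatticeOrdered P)
    (hT : Function.Injective (piT P)) : IsAmenable P := by
  refine ⟨hP, ?_⟩
  let Ψ := (diagIsometry hT).equivRange
  -- The expectation is the diagonal of the matrix, pulled back through the isometric embedding of
  -- the diagonal subspace.
  let Φ₀ : CStar P →ₗ[ℂ] diagonal P :=
    Ψ.symm.toLinearEquiv.toLinearMap.comp
      ((diagCoeff P).toLinearMap.codRestrict _ (diagCoeff_mem_range hP hT))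
  have hΨ : ∀ a, diagCoeff P (Φ₀ a : CStar P) = diagCoeff P a := fun a =>
    congrArg Subtype.val (Ψ.apply_symm_apply ⟨diagCoeff P a, diagCoeff_mem_range hP hT a⟩)
  have hn : ∀ a, ‖Φ₀ a‖ ≤ 1 * ‖a‖ := fun a => by
    rw [one_mul, ← (diagIsometry hT).norm_map]
    show ‖diagCoeff P (Φ₀ a : CStar P)‖ ≤ _
    rw [hΨ]
    exact norm_diagCoeff_le a
  have hinj : ∀ b c : diagonal P, diagCoeff P (b : CStar P) = diagCoeff P c → b = c :=
    fun b c h => (diagIsometry hT).injective h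
  refine ⟨Φ₀.mkContinuous 1 hn, ⟨LinearMap.mkContinuous_norm_le _ zero_le_one _, fun x => ?_,
    fun x y hxy => ?_⟩, fun R hR => ?_⟩
  · exact congrArg Subtype.val (hinj (Φ₀ _)
      ⟨_, Submodule.le_topologicalClosure _ (Submodule.subset_span ⟨x, rfl⟩)⟩ (hΨ _))
  · refine hinj (Φ₀ _) 0 ?_
    rw [hΨ, diagCoeff_i_mul_star_of_ne hxy]
    simp
  · have h : Φ₀ (star R * R) = 0 := hR
    refine hT ?_
    rw [map_zero, piT_eq_zero_iff]
    refine opT_eq_zero_of_diagCoeff ?_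
    rw [← hΨ, h]
    simp

end QuasiLattice

/-! ### Faithfulness of integration on positive continuous functions -/

section IntegralFaithful

open MeasureTheory

/-- On the neighbourhood U of s where ‖f s - f t‖ < ε, f dominates the constant f s - ε, and
elsewhere it dominates 0. Integration gives μ(U)(f s - ε) ≤ 0 with μ(U) > 0, so f s ≤ ε for all ε.
-/
theorem MeasureTheory.eq_zero_of_integral_eq_zero_of_nonneg {X A : Type*} [TopologicalSpace X]
    [CompactSpace X] [MeasurableSpace X] [BorelSpace X] (μ : Measure X) [IsFiniteMeasure μ]
    [μ.IsOpenPosMeasure] [CStarAlgebra A] [PartialOrder A] [StarOrderedRing A] (f : C(X, A))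
    (hf : ∀ t, 0 ≤ f t) (hzero : ∫ t, f t ∂μ = 0) (s : X) : f s = 0 := by
  have hfi : Integrable f μ := f.continuous.integrable_of_hasCompactSupport
    (HasCompactSupport.of_compactSpace f)
  rw [← norm_le_zero_iff]
  refine le_of_forall_pos_le_add fun ε hε => ?_
  rw [zero_add, CStarAlgebra.norm_le_iff_le_algebraMap (f s) hε.le (hf s)]
  set U : Set X := {t | ‖f s - f t‖ < ε} with hU
  have hUo : IsOpen U := isOpen_lt (by fun_prop) continuous_const
  have hsU : s ∈ U := by simpa [hU] using hε
  have hpos : 0 < μ.real U := by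
    rw [Measure.real, ENNReal.toReal_pos_iff]
    exact ⟨hUo.measure_pos μ ⟨s, hsU⟩, measure_lt_top μ U⟩
  set g : X → A := U.indicator fun _ => f s - algebraMap ℝ A ε with hg
  have hgi : Integrable g μ := (integrable_const _).indicator hUo.measurableSet
  have hle : g ≤ f := fun t => by
    by_cases ht : t ∈ U
    · rw [hg, Set.indicator_of_mem ht, sub_le_iff_le_add, ← sub_le_iff_le_add']
      have hsa : IsSelfAdjoint (f s - f t) :=
        (IsSelfAdjoint.of_nonneg (hf s)).sub (IsSelfAdjoint.of_nonneg (hf t))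
      exact hsa.le_algebraMap_norm_self.trans (algebraMap_mono A (le_of_lt ht))
    · rw [hg, Set.indicator_of_notMem ht]
      exact hf t
  have h := integral_mono hgi hfi hle
  rw [hzero, hg, integral_indicator_const _ hUo.measurableSet] at h
  have h' := smul_le_smul_of_nonneg_left h (inv_nonneg.2 hpos.le)
  rwa [inv_smul_smul₀ hpos.ne', smul_zero, sub_nonpos] at h'

end IntegralFaithful

namespace QuasiLattice

open MeasureTheory AddCircle

variable {G : Type u} [Group G] {P : Submonoid G} (θ : P →* Multiplicative ℕ)

/-! ### The gauge action of a grading `θ : P → ℕ` -/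

/-- The grading, with values in `ℤ`. -/
def degree (x : P) : ℤ := ((θ x).toAdd : ℤ)

theorem degree_mul (x y : P) : degree θ (x * y) = degree θ x + degree θ y := by
  simp [degree]

theorem degree_one : degree θ (1 : P) = 0 := by
  simp [degree]

theorem fourier_mul_star_fourier (n : ℤ) (t : UnitAddCircle) :
    fourier n t * star (fourier n t) = 1 := by
  rw [RCLike.star_def, ← fourier_neg, ← fourier_add, add_neg_cancel, fourier_zero]

/-- The homomorphism `x ↦ z^θ(x) i(x)` to the continuous functions of `z`. -/
def gaugeHom : P →* C(UnitAddCircle, CStar P) where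
  toFun x := ⟨fun t => fourier (degree θ x) t • CStar.i x, by fun_prop⟩
  map_one' := by
    ext t
    simp only [ContinuousMap.coe_mk, degree_one, fourier_zero, CStar.i_one, one_smul]
    rfl
  map_mul' x y := by
    ext t
    simp only [ContinuousMap.coe_mk, degree_mul, fourier_add, CStar.i_mul,
      ContinuousMap.mul_apply, smul_mul_smul_comm]

theorem gaugeHom_apply (x : P) (t : UnitAddCircle) :
    gaugeHom θ x t = fourier (degree θ x) t • CStar.i x := rfl

theorem gaugeHom_mul_star_apply (x : P) (t : UnitAddCircle) :
    gaugeHom θ x t * star (gaugeHom θ x t) = CStar.i x * star (CStar.i x) := by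
  rw [gaugeHom_apply, star_smul, smul_mul_smul_comm, fourier_mul_star_fourier, one_smul]

/-- The representation `x ↦ z^θ(x) i(x)` in the continuous functions of `z`. -/
def gaugeRep : NicaRep P C(UnitAddCircle, CStar P) where
  toHom := gaugeHom θ
  isometry x := by
    ext t
    rw [ContinuousMap.mul_apply, ContinuousMap.star_apply, gaugeHom_apply, star_smul,
      smul_mul_smul_comm, mul_comm, fourier_mul_star_fourier, one_smul, CStar.star_i_mul_self]
    rfl
  cov_join x y z h := by
    ext t
    simp only [ContinuousMap.mul_apply, ContinuousMap.star_apply, gaugeHom_mul_star_apply]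
    exact (CStar.univ P).cov_join x y z h
  cov_infty x y h := by
    ext t
    simp only [ContinuousMap.mul_apply, ContinuousMap.star_apply, gaugeHom_mul_star_apply]
    exact (CStar.univ P).cov_infty x y h

/-- The gauge coaction `C⋆(G, P) → C(𝕋, C⋆(G, P))`. -/
def gauge : CStar P →⋆ₐ[ℂ] C(UnitAddCircle, CStar P) := CStar.lift (gaugeRep θ)

theorem gauge_i (x : P) (t : UnitAddCircle) :
    gauge θ (CStar.i x) t = fourier (degree θ x) t • CStar.i x := by
  rw [gauge, CStar.lift_i]; rfl

theorem gauge_i_mul_star (x y : P) (t : UnitAddCircle) :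
    gauge θ (CStar.i x * star (CStar.i y)) t =
      fourier (degree θ x - degree θ y) t • (CStar.i x * star (CStar.i y)) := by
  rw [map_mul, map_star, ContinuousMap.mul_apply, ContinuousMap.star_apply, gauge_i, gauge_i,
    star_smul, smul_mul_smul_comm, RCLike.star_def, ← fourier_neg, ← fourier_add, sub_eq_add_neg]

theorem gauge_apply_zero (a : CStar P) : gauge θ a 0 = a := by
  let ev : C(UnitAddCircle, CStar P) →⋆ₐ[ℂ] CStar P :=
    { toFun := fun f => f 0
      map_one' := rfl
      map_mul' := fun _ _ => rfl
      map_zero' := rfl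
      map_add' := fun _ _ => rfl
      commutes' := fun _ => rfl
      map_star' := fun _ => rfl }
  have h : ev.comp (gauge θ) =
      StarAlgHom.id ℂ (CStar P) :=
    CStar.hom_ext fun x => by
      show gauge θ (CStar.i x) 0 = CStar.i x
      rw [gauge_i, fourier_eval_zero, one_smul]
  exact DFunLike.congr_fun h a

theorem norm_gauge_le (a : CStar P) : ‖gauge θ a‖ ≤ ‖a‖ := by
  open scoped CStarAlgebra in exact NonUnitalStarAlgHom.norm_apply_le (gauge θ) a

theorem continuous_gauge : Continuous (gauge θ) := by
  open scoped CStarAlgebra in exact map_continuous (gauge θ)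

/-- The gauge action multiplies matrix coefficients of the Toeplitz representation by scalars. -/
theorem opT_gauge_apply (hP : IsQuasiLatticeOrdered P) (a : CStar P) (t : UnitAddCircle)
    (x y : P) : opT (gauge θ a t) (e x) y =
      fourier (degree θ y - degree θ x) t * opT a (e x) y := by
  classical
  refine CStar.dense_induction hP (p := fun a => opT (gauge θ a t) (e x) y =
      fourier (degree θ y - degree θ x) t * opT a (e x) y) ?_ ?_ ?_ ?_ ?_ a
  · refine isClosed_eq ?_ (continuous_const.mul (continuous_opT_apply _ y))
    exact (continuous_opT_apply _ y).comp ((continuous_eval_const t).comp (continuous_gauge θ))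
  · simp
  · intro a b ha hb
    rw [map_add, ContinuousMap.add_apply, opT_add, opT_add]
    simp only [_root_.add_apply, lp.coeFn_add, Pi.add_apply, ha, hb, mul_add]
  · intro c a ha
    rw [map_smul, ContinuousMap.smul_apply, opT_smul, opT_smul]
    simp only [_root_.smul_apply, lp.coeFn_smul, Pi.smul_apply, ha, smul_eq_mul]
    ring
  · intro z w
    rw [gauge_i_mul_star, opT_smul]
    simp only [_root_.smul_apply, lp.coeFn_smul, Pi.smul_apply, smul_eq_mul]
    by_cases hz : PLe P (z : G) y
    · obtain ⟨v, rfl⟩ := hz.exists_eq_mul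
      rw [opT_i_mul_star_apply_mul, e_apply]
      split_ifs with h
      · rw [← h, degree_mul, degree_mul, add_sub_add_right_eq_sub]
      · simp
    · rw [opT_i_mul_star_apply_of_not_le z w hz]; simp

theorem opT_gauge_eq_zero (hP : IsQuasiLatticeOrdered P) {a : CStar P} (ha : opT a = 0)
    (t : UnitAddCircle) : opT (gauge θ a t) = 0 := by
  refine eq_zero_of_apply_e fun x => ?_
  ext y
  rw [opT_gauge_apply θ hP, ha]
  simp

theorem integrable_gauge (a : CStar P) :
    Integrable (fun t => gauge θ a t) (haarAddCircle (T := 1)) :=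
  (gauge θ a).continuous.integrable_of_hasCompactSupport (HasCompactSupport.of_compactSpace _)

/-- The average over the gauge action. -/
def gaugeAverage (a : CStar P) : CStar P := ∫ t : UnitAddCircle, gauge θ a t ∂haarAddCircle

theorem gaugeAverage_add (a b : CStar P) :
    gaugeAverage θ (a + b) = gaugeAverage θ a + gaugeAverage θ b := by
  rw [gaugeAverage, gaugeAverage, gaugeAverage,
    ← integral_add (integrable_gauge θ a) (integrable_gauge θ b)]
  simp

theorem gaugeAverage_smul (c : ℂ) (a : CStar P) :
    gaugeAverage θ (c • a) = c • gaugeAverage θ a := by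
  rw [gaugeAverage, gaugeAverage, ← integral_smul]
  simp

theorem gaugeAverage_zero : gaugeAverage θ (0 : CStar P) = 0 := by
  simp [gaugeAverage]

theorem norm_gaugeAverage_le (a : CStar P) : ‖gaugeAverage θ a‖ ≤ ‖a‖ := by
  have h := norm_integral_le_of_norm_le_const (μ := haarAddCircle (T := 1))
    (f := fun t => gauge θ a t) (C := ‖a‖)
    (Filter.Eventually.of_forall fun t => ((gauge θ a).norm_coe_le_norm t).trans
      (norm_gauge_le θ a))
  rw [probReal_univ, mul_one] at h
  exact h

theorem continuous_gaugeAverage : Continuous (gaugeAverage θ) :=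
  (LinearMap.mkContinuous (σ := RingHom.id ℂ)
    { toFun := gaugeAverage θ
      map_add' := gaugeAverage_add θ
      map_smul' := gaugeAverage_smul θ } 1
    (fun a => by rw [one_mul]; exact norm_gaugeAverage_le θ a)).continuous

/-- A suitable translation changes the sign of the character and preserves Haar measure. -/
theorem integral_fourier {n : ℤ} (hn : n ≠ 0) :
    ∫ t : UnitAddCircle, fourier n t ∂haarAddCircle = 0 :=
  integral_eq_zero_of_add_right_eq_neg (μ := haarAddCircle)
    (fourier_add_half_inv_index hn one_pos)

theorem gaugeAverage_i_mul_star (x y : P) :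
    gaugeAverage θ (CStar.i x * star (CStar.i y)) =
      if degree θ x = degree θ y then CStar.i x * star (CStar.i y) else 0 := by
  rw [gaugeAverage]
  simp only [gauge_i_mul_star]
  rw [integral_smul_const]
  split_ifs with h
  · simp [h]
  · rw [integral_fourier (sub_ne_zero.2 h), zero_smul]

theorem gaugeAverage_mem (hP : IsQuasiLatticeOrdered P) (a : CStar P) :
    gaugeAverage θ a ∈ (CStar.spanOn fun x y : P => θ x = θ y).topologicalClosure := by
  refine CStar.dense_induction hP (p := fun a => gaugeAverage θ a ∈
    (CStar.spanOn fun x y : P => θ x = θ y).topologicalClosure) ?_ ?_ ?_ ?_ ?_ a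
  · exact (Submodule.isClosed_topologicalClosure _).preimage (continuous_gaugeAverage θ)
  · rw [gaugeAverage_zero]; exact zero_mem _
  · intro a b ha hb; rw [gaugeAverage_add]; exact add_mem ha hb
  · intro c a ha; rw [gaugeAverage_smul]; exact Submodule.smul_mem _ _ ha
  · intro x y
    rw [gaugeAverage_i_mul_star]
    split_ifs with h
    · refine Submodule.le_topologicalClosure _ (CStar.mem_spanOn ?_)
      simpa [degree] using h
    · exact zero_mem _

/-- The kernel of π_T is invariant under the gauge action, and the continuous linear map `opT`
commutes with the integral. -/
theorem opT_gaugeAverage_eq_zero (hP : IsQuasiLatticeOrdered P) {a : CStar P} (ha : opT a = 0) :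
    opT (gaugeAverage θ a) = 0 := by
  let L : CStar P →L[ℂ] (ell2 P →L[ℂ] ell2 P) :=
    { toFun := opT
      map_add' := opT_add
      map_smul' := opT_smul
      cont := continuous_opT }
  show L (gaugeAverage θ a) = 0
  rw [gaugeAverage, ← L.integral_comp_comm (integrable_gauge θ a)]
  exact (integral_congr_ae (Filter.Eventually.of_forall fun t =>
    opT_gauge_eq_zero θ hP ha t)).trans (integral_zero _ _)

/-- The orbit of a⋆a is a continuous positive function with integral zero, so it vanishes, in
particular at the identity of the circle, where its value is a⋆a. -/
theorem eq_zero_of_gaugeAverage (a : CStar P) (h : gaugeAverage θ (star a * a) = 0) : a = 0 := by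
  let _ := CStarAlgebra.spectralOrder (CStar P)
  have _ := CStarAlgebra.spectralOrderedRing (CStar P)
  have h0 := MeasureTheory.eq_zero_of_integral_eq_zero_of_nonneg
    (haarAddCircle (T := 1)) (gauge θ (star a * a)) (fun t => by
      rw [map_mul, map_star]
      exact star_mul_self_nonneg _) h 0
  rw [gauge_apply_zero] at h0
  exact CStarRing.star_mul_self_eq_zero_iff a |>.1 h0

end QuasiLattice

namespace QuasiLattice

variable {G : Type u} [Group G] {P : Submonoid G} (θ : P →* Multiplicative ℕ)

/-! ### Faithfulness of the Toeplitz representation from estimates on levels -/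

/-- The height of an element for the grading `θ`. -/
def height (x : P) : ℕ := (θ x).toAdd

theorem height_mul (x y : P) : height θ (x * y) = height θ x + height θ y := by
  simp [height]

theorem height_one : height θ (1 : P) = 0 := by
  simp [height]

/-- A lower bound for the Toeplitz representation on the span of the `i(x) i(y)⋆` with `x`, `y` of
height `k`, tested on vectors supported on the elements of height `k`. -/
def LevelBound (k : ℕ) : Prop :=
  ∃ C : ℝ, 0 ≤ C ∧ ∀ a ∈ CStar.spanOn (fun x y : P => height θ x = k ∧ height θ y = k),
    ∀ M : ℝ, 0 ≤ M → (∀ f : ell2 P, (∀ p, height θ p ≠ k → f p = 0) → ‖opT a f‖ ≤ M * ‖f‖) →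
      ‖a‖ ≤ C * M

theorem opT_i_mul_star_eq_zero {k : ℕ} {x y : P} (hy : k < height θ y) {f : ell2 P}
    (hf : ∀ p, k < height θ p → f p = 0) : opT (CStar.i x * star (CStar.i y)) f = 0 := by
  have : star (T y) f = 0 := by
    ext p
    rw [star_T_apply, hf]
    · rfl
    · rw [height_mul]; omega
  rw [opT_mul, opT_star, opT_i, opT_i, mul_apply_eq_comp, this, map_zero]

/-- If y has height n, then T_y⋆ f reads off f only at elements of height at least n. This is the
triangularity behind the induction on levels. -/
theorem opT_eq_zero_of_mem_level {k n : ℕ} (hkn : k < n) {a : CStar P}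
    (ha : a ∈ CStar.spanOn (fun x y : P => height θ x = n ∧ height θ y = n)) {f : ell2 P}
    (hf : ∀ p, k < height θ p → f p = 0) : opT a f = 0 := by
  refine CStar.spanOn_induction (p := fun a => opT a f = 0) ?_ ?_ ?_ ?_ ha
  · simp
  · intro a b ha hb; simp [opT_add, ha, hb]
  · intro c a ha; simp [opT_smul, ha]
  · intro x y h
    exact opT_i_mul_star_eq_zero θ (hkn.trans_eq h.2.symm) hf

/-- The part of the core of height at most `k`. -/
def coreUpTo (k : ℕ) : Submodule ℂ (CStar P) :=
  CStar.spanOn fun x y : P => height θ x = height θ y ∧ height θ x ≤ k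

theorem exists_level_decomposition (k : ℕ) {a : CStar P} (ha : a ∈ coreUpTo θ (k + 1)) :
    ∃ b ∈ coreUpTo θ k,
      ∃ c ∈ CStar.spanOn (fun x y : P => height θ x = k + 1 ∧ height θ y = k + 1), b + c = a := by
  rw [← Submodule.mem_sup]
  refine CStar.spanOn_induction (p := fun a => a ∈ coreUpTo θ k ⊔
    CStar.spanOn (fun x y : P => height θ x = k + 1 ∧ height θ y = k + 1))
    (zero_mem _) (fun _ _ => add_mem) (fun c _ => Submodule.smul_mem _ c) ?_ ha
  rintro x y ⟨hxy, hk⟩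
  rcases Nat.lt_or_ge (height θ x) (k + 1) with h | h
  · exact Submodule.mem_sup_left (CStar.mem_spanOn ⟨hxy, by omega⟩)
  · exact Submodule.mem_sup_right (CStar.mem_spanOn ⟨by omega, by omega⟩)

/-- Vectors supported in heights at most k see only the part b of b + c that lies below the top
level, which bounds b by induction. Subtracting b bounds the top part c by its action on vectors of
height k + 1. -/
theorem norm_le_of_mem_coreUpTo (hlev : ∀ k, LevelBound θ k) (k : ℕ) :
    ∃ C : ℝ, 0 ≤ C ∧ ∀ a ∈ coreUpTo θ k, ∀ M : ℝ, 0 ≤ M →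
      (∀ f : ell2 P, (∀ p, k < height θ p → f p = 0) → ‖opT a f‖ ≤ M * ‖f‖) → ‖a‖ ≤ C * M := by
  induction k with
  | zero =>
    obtain ⟨C, hC, h⟩ := hlev 0
    refine ⟨C, hC, fun a ha M hM hf => h a ?_ M hM fun f hf0 => hf f fun p hp => hf0 p hp.ne'⟩
    exact CStar.spanOn_mono (fun x y hxy => ⟨by omega, by omega⟩) ha
  | succ k ih =>
    obtain ⟨C, hC, hle⟩ := ih
    obtain ⟨D, hD, hlev⟩ := hlev (k + 1)
    -- The summand C bounds the lower part; on the top level the operator is bounded by M + C * M,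
    -- which the level estimate multiplies by D.
    refine ⟨C + D * (1 + C), by positivity, fun a ha M hM hf => ?_⟩
    obtain ⟨b, hb, c, hc, rfl⟩ := exists_level_decomposition θ k ha
    have hb' : ‖b‖ ≤ C * M := hle b hb M hM fun f hfk => by
      have h := hf f fun p hp => hfk p (by omega)
      rwa [opT_add, _root_.add_apply, opT_eq_zero_of_mem_level θ (Nat.lt_succ_self k) hc hfk,
        add_zero] at h
    have hc' : ‖c‖ ≤ D * (M + C * M) := hlev c hc _ (by positivity) fun f hfk => by
      have h1 := hf f fun p hp => hfk p (by omega)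
      have h2 : ‖opT b f‖ ≤ C * M * ‖f‖ := ((opT b).le_opNorm f).trans
        (mul_le_mul_of_nonneg_right ((norm_piT_le b).trans hb') (norm_nonneg f))
      have h3 : opT c f = opT (b + c) f - opT b f := by
        rw [opT_add, _root_.add_apply, add_sub_cancel_left]
      rw [h3, add_mul]
      exact (norm_sub_le _ _).trans (add_le_add h1 h2)
    calc ‖b + c‖ ≤ C * M + D * (M + C * M) := (norm_add_le _ _).trans (add_le_add hb' hc')
      _ = _ := by ring

/-- Otherwise the powers of x / y would outgrow C. This turns a lower bound with a constant into an
isometry, as in the spectral radius argument. -/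
theorem le_of_forall_pow_two_pow_le {x y C : ℝ} (hy : 0 ≤ y)
    (h : ∀ n : ℕ, x ^ 2 ^ n ≤ C * y ^ 2 ^ n) : x ≤ y := by
  by_contra! hlt
  rcases hy.eq_or_lt with rfl | hy
  · have := h 0
    simp at this
    linarith
  · have h1 : 1 < x / y := (one_lt_div hy).2 hlt
    obtain ⟨n, hn⟩ := pow_unbounded_of_one_lt C h1
    have h2 := hn.trans_le (pow_le_pow_right₀ h1.le (Nat.lt_two_pow_self (n := n)).le)
    rw [div_pow, lt_div_iff₀ (by positivity)] at h2
    exact absurd (h n) (not_le.2 h2)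

theorem opT_pow (a : CStar P) (n : ℕ) : opT (a ^ n) = opT a ^ n := by
  simp [opT]

theorem one_mem_coreUpTo (k : ℕ) : (1 : CStar P) ∈ coreUpTo θ k := by
  have := CStar.mem_spanOn (r := fun x y : P => height θ x = height θ y ∧ height θ x ≤ k)
    (x := 1) (y := 1) ⟨rfl, by rw [height_one]; exact Nat.zero_le _⟩
  rwa [CStar.i_one, star_one, mul_one] at this

/-- The Toeplitz representation is isometric on the core. -/
theorem norm_opT_of_mem_coreUpTo (hP : IsQuasiLatticeOrdered P)
    (hθ : ∀ x y z : P, IsJoin P (x : G) y z → height θ z ≤ max (height θ x) (height θ y))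
    (hlev : ∀ k, LevelBound θ k) {k : ℕ} {a : CStar P} (ha : a ∈ coreUpTo θ k) :
    ‖a‖ ≤ ‖opT a‖ := by
  -- The same constant must serve all powers of `star a * a`, so the heights must not grow under
  -- products; this is where the hypothesis on joins enters.
  have hmul : ∀ b c, b ∈ coreUpTo θ k → c ∈ coreUpTo θ k → b * c ∈ coreUpTo θ k := by
    intro b c hb hc
    refine CStar.mul_mem_spanOn hP ?_ hb hc
    rintro x y z w u v ⟨hxy, hx⟩ ⟨hzw, hz⟩ huv hj
    have h1 := congrArg (height θ) huv
    have h2 := hθ y z (y * u) hj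
    have h3 : max (height θ y) (height θ z) ≤ k := max_le (by omega) hz
    rw [height_mul] at h2
    simp only [height_mul] at h1 ⊢
    omega
  have hpow : ∀ b n, b ∈ coreUpTo θ k → b ^ n ∈ coreUpTo θ k := by
    intro b n hb
    induction n with
    | zero => rw [pow_zero]; exact one_mem_coreUpTo θ k
    | succ n ih => rw [pow_succ]; exact hmul _ _ ih hb
  obtain ⟨C, -, hle⟩ := norm_le_of_mem_coreUpTo θ hlev k
  have hsa : ‖star a * a‖ ≤ ‖opT (star a * a)‖ := by
    refine le_of_forall_pow_two_pow_le (C := C) (norm_nonneg _) fun n => ?_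
    -- The C⋆-identity for a self-adjoint element, iterated n times.
    have h1 : ‖(star a * a) ^ 2 ^ n‖ = ‖star a * a‖ ^ 2 ^ n := by
      have := (IsSelfAdjoint.star_mul_self a).nnnorm_pow_two_pow n
      exact congrArg NNReal.toReal this
    rw [← h1]
    refine hle _ (hpow _ _ (hmul _ _ ?_ ha)) _ (by positivity) fun f _ => ?_
    · exact CStar.star_mem_spanOn (fun x y h => ⟨h.1.symm, by omega⟩) ha
    · refine ((opT _).le_opNorm f).trans (mul_le_mul_of_nonneg_right ?_ (norm_nonneg f))
      rw [opT_pow]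
      exact norm_pow_le' _ (by positivity)
  rw [norm_opT, map_mul, map_star, CStarRing.norm_star_mul_self,
    CStarRing.norm_star_mul_self] at hsa
  exact (mul_self_le_mul_self_iff (norm_nonneg _) (norm_nonneg _)).2 hsa

theorem exists_mem_coreUpTo {a : CStar P} (ha : a ∈ CStar.spanOn fun x y : P => θ x = θ y) :
    ∃ k, a ∈ coreUpTo θ k := by
  refine CStar.spanOn_induction (p := fun a => ∃ k, a ∈ coreUpTo θ k) ?_ ?_ ?_ ?_ ha
  · exact ⟨0, zero_mem _⟩
  · rintro a b ⟨k, ha⟩ ⟨l, hb⟩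
    refine ⟨max k l, add_mem (CStar.spanOn_mono ?_ ha) (CStar.spanOn_mono ?_ hb)⟩
    · exact fun x y h => ⟨h.1, h.2.trans (le_max_left _ _)⟩
    · exact fun x y h => ⟨h.1, h.2.trans (le_max_right _ _)⟩
  · rintro c a ⟨k, ha⟩
    exact ⟨k, Submodule.smul_mem _ _ ha⟩
  · intro x y h
    exact ⟨height θ x, CStar.mem_spanOn ⟨congrArg Multiplicative.toAdd h, le_rfl⟩⟩

/-- If joins have height the maximum of the heights, lower bounds on the levels imply that the
Toeplitz representation is faithful. -/
theorem piT_injective_of_levelBound (hP : IsQuasiLatticeOrdered P)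
    (hθ : ∀ x y z : P, IsJoin P (x : G) y z → height θ z ≤ max (height θ x) (height θ y))
    (hlev : ∀ k, LevelBound θ k) : Function.Injective (piT P) := by
  rw [injective_iff_map_eq_zero]
  intro a ha
  rw [piT_eq_zero_iff] at ha
  refine eq_zero_of_gaugeAverage θ a ?_
  have h1 : opT (gaugeAverage θ (star a * a)) = 0 :=
    opT_gaugeAverage_eq_zero θ hP (by rw [opT_mul, ha, mul_zero])
  have h2 : ∀ b ∈ (CStar.spanOn fun x y : P => θ x = θ y).topologicalClosure, ‖b‖ ≤ ‖opT b‖ := by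
    intro b hb
    have hcl : IsClosed {b : CStar P | ‖b‖ ≤ ‖opT b‖} :=
      isClosed_le continuous_norm continuous_opT.norm
    refine closure_minimal ?_ hcl hb
    intro b hb
    obtain ⟨k, hk⟩ := exists_mem_coreUpTo θ hb
    exact norm_opT_of_mem_coreUpTo θ hP hθ hlev hk
  have h3 := h2 _ (gaugeAverage_mem θ hP (star a * a))
  rwa [h1, norm_zero, norm_le_zero_iff] at h3

end QuasiLattice

namespace QuasiLattice

variable {G : Type u} [Group G]

/-! ### The semigroup generated by an element of infinite order -/

section Powers

variable {b : G}

theorem zpow_mem_powers_iff (hb : Function.Injective fun n : ℤ => b ^ n) {n : ℤ} :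
    b ^ n ∈ Submonoid.powers b ↔ 0 ≤ n := by
  constructor
  · rintro ⟨m, hm⟩
    have : (m : ℤ) = n := hb (by simpa using hm)
    omega
  · intro h
    lift n to ℕ using h
    exact ⟨n, by simp⟩

theorem pLe_powers_iff (hb : Function.Injective fun n : ℤ => b ^ n) {m n : ℤ} :
    PLe (Submonoid.powers b) (b ^ m) (b ^ n) ↔ m ≤ n := by
  rw [PLe, ← zpow_neg, ← zpow_add, zpow_mem_powers_iff hb]
  omega

theorem exists_zpow_of_pLe_powers {g : G} {n : ℤ} (h : PLe (Submonoid.powers b) g (b ^ n)) :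
    ∃ m : ℤ, g = b ^ m := by
  obtain ⟨k, hk⟩ := h
  refine ⟨n - k, ?_⟩
  have hk' : b ^ k = g⁻¹ * b ^ n := hk
  rw [zpow_sub, zpow_natCast, hk']
  group

theorem isQuasiLatticeOrdered_powers (hb : Function.Injective fun n : ℤ => b ^ n) :
    IsQuasiLatticeOrdered (Submonoid.powers b) where
  eq_one := by
    rintro _ ⟨n, rfl⟩ h
    have h' : b ^ (-(n : ℤ)) ∈ Submonoid.powers b := by simpa using h
    rw [zpow_mem_powers_iff hb] at h'
    have : n = 0 := by omega
    simp [this]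
  exists_join := by
    rintro g h ⟨_, ⟨n, rfl⟩, hg, hh⟩
    have hn : b ^ n = b ^ (n : ℤ) := by simp
    simp only [hn] at hg hh
    obtain ⟨i, rfl⟩ := exists_zpow_of_pLe_powers hg
    obtain ⟨j, rfl⟩ := exists_zpow_of_pLe_powers hh
    -- The 0 is there because g and h may be negative powers while the join must lie in the monoid.
    refine ⟨b ^ (max 0 (max i j)), ⟨?_, ?_, ?_⟩, ?_⟩
    · rw [zpow_mem_powers_iff hb]; omega
    · rw [pLe_powers_iff hb]; omega
    · rw [pLe_powers_iff hb]; omega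
    · rintro _ ⟨⟨k, rfl⟩, hi, hj⟩
      have hk : b ^ k = b ^ (k : ℤ) := by simp
      simp only [hk, pLe_powers_iff hb] at *
      omega

/-- Because the order is total, range projections of isometries are nested and Nica covariance is
automatic. -/
theorem powers_total (x y : Submonoid.powers b) : (∃ u, y = x * u) ∨ ∃ u, x = y * u := by
  obtain ⟨_, m, rfl⟩ := x
  obtain ⟨_, n, rfl⟩ := y
  rcases le_total m n with h | h
  · exact Or.inl ⟨⟨b ^ (n - m), n - m, rfl⟩, Subtype.ext (pow_mul_pow_sub b h).symm⟩
  · exact Or.inr ⟨⟨b ^ (m - n), m - n, rfl⟩, Subtype.ext (pow_mul_pow_sub b h).symm⟩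

theorem pLe_mul {P : Submonoid G} (x u : P) : PLe P (x : G) (x * u : P) := by
  simp [PLe]

theorem pLe_refl {P : Submonoid G} (g : G) : PLe P g g := by
  simp [PLe, one_mem]

theorem IsQuasiLatticeOrdered.antisymm {P : Submonoid G} (hP : IsQuasiLatticeOrdered P) {g h : G}
    (h₁ : PLe P g h) (h₂ : PLe P h g) : g = h :=
  eq_of_inv_mul_eq_one (hP.eq_one _ h₁ (by rwa [mul_inv_rev, inv_inv]))

/-- A representation of the powers of `b` by isometries is Nica covariant. -/
def NicaRep.ofPowers (hb : Function.Injective fun n : ℤ => b ^ n) {B : Type u} [CStarAlgebra B]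
    (V : Submonoid.powers b →* B) (hV : ∀ x, star (V x) * V x = 1) :
    NicaRep (Submonoid.powers b) B where
  toHom := V
  isometry := hV
  cov_join x y z hz := by
    have key : ∀ x u : Submonoid.powers b,
        V x * star (V x) * (V (x * u) * star (V (x * u))) = V (x * u) * star (V (x * u)) := by
      intro x u
      have h : V x * star (V x) * V (x * u) = V (x * u) := by
        rw [map_mul, mul_assoc, ← mul_assoc (star _), hV, one_mul]
      rw [← mul_assoc, h]
    have hanti : ∀ w : Submonoid.powers b, IsUpper (Submonoid.powers b) (x : G) y w →
        PLe (Submonoid.powers b) (w : G) z → w = z := fun w hw hwz =>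
      Subtype.ext ((isQuasiLatticeOrdered_powers hb).antisymm hwz (hz.2 w hw))
    rcases powers_total x y with ⟨u, rfl⟩ | ⟨u, rfl⟩
    · rw [key, hanti _ ⟨Subtype.prop _, pLe_mul _ _, pLe_refl _⟩ hz.1.2.2]
    · rw [← hanti _ ⟨Subtype.prop _, pLe_refl _, pLe_mul _ _⟩ hz.1.2.1, ← star_inj]
      simpa using key y u
  cov_infty x y h := by
    refine absurd ?_ h
    rcases powers_total x y with ⟨u, rfl⟩ | ⟨u, rfl⟩
    · exact ⟨_, Subtype.prop _, pLe_mul _ _, pLe_refl _⟩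
    · exact ⟨_, Subtype.prop _, pLe_refl _, pLe_mul _ _⟩

open Classical in
/-- The exponent, as a grading of the powers of `b`. -/
def powersGrading (hb : Function.Injective fun n : ℤ => b ^ n) :
    Submonoid.powers b →* Multiplicative ℕ :=
  (Submonoid.powLogEquiv (n := b) fun m n h => by
    have := @hb m n (by simpa using h)
    exact_mod_cast this).symm.toMonoidHom

theorem powersGrading_injective (hb : Function.Injective fun n : ℤ => b ^ n) :
    Function.Injective (powersGrading hb) :=
  MulEquiv.injective _

/-- Only one element x has height k, so the level consists of the multiples r i(x) i(x)⋆. The matrix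
entry at (x, x) recovers r. -/
theorem levelBound_powers (hb : Function.Injective fun n : ℤ => b ^ n) (k : ℕ) :
    LevelBound (powersGrading hb) k := by
  classical
  refine ⟨1, zero_le_one, fun a ha M hM hf => ?_⟩
  rw [one_mul]
  have hinj : ∀ x y : Submonoid.powers b,
      height (powersGrading hb) x = height (powersGrading hb) y → x = y := fun x y h =>
    powersGrading_injective hb (Multiplicative.toAdd.injective h)
  have hform : a = 0 ∨ ∃ x : Submonoid.powers b, height (powersGrading hb) x = k ∧
      ∃ r : ℂ, a = r • (CStar.i x * star (CStar.i x)) := by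
    refine CStar.spanOn_induction (p := fun a => a = 0 ∨ ∃ x : Submonoid.powers b,
      height (powersGrading hb) x = k ∧ ∃ r : ℂ, a = r • (CStar.i x * star (CStar.i x)))
      (Or.inl rfl) ?_ ?_ ?_ ha
    · rintro a c (rfl | ⟨x, hx, r, rfl⟩) (rfl | ⟨y, hy, s, rfl⟩)
      · simp
      · exact Or.inr ⟨y, hy, s, by simp⟩
      · exact Or.inr ⟨x, hx, r, by simp⟩
      · obtain rfl := hinj x y (hx.trans hy.symm)
        exact Or.inr ⟨x, hx, r + s, by rw [add_smul]⟩
    · rintro c a (rfl | ⟨x, hx, r, rfl⟩)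
      · simp
      · exact Or.inr ⟨x, hx, c * r, by rw [mul_smul]⟩
    · rintro x y ⟨hx, hy⟩
      obtain rfl := hinj x y (hx.trans hy.symm)
      exact Or.inr ⟨x, hx, 1, by simp⟩
  rcases hform with rfl | ⟨x, hx, r, rfl⟩
  · simpa using hM
  · have h1 := hf (e x) fun p hp => by
      rw [e_apply, if_neg]
      rintro rfl
      exact hp hx
    rw [norm_e, mul_one] at h1
    have h2 : opT (r • (CStar.i x * star (CStar.i x))) (e x) x = r := by
      have := opT_i_mul_star_apply_mul x x 1 (e x)
      rw [mul_one, e_apply, if_pos rfl] at this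
      rw [opT_smul]
      simp [this]
    have h3 : ‖r‖ ≤ M := by
      rw [← h2]
      exact (norm_apply_le _ x).trans h1
    refine le_trans ?_ h3
    rw [norm_smul]
    refine mul_le_of_le_one_right (norm_nonneg _) ?_
    rw [CStarRing.norm_self_mul_star]
    exact mul_le_one₀ (CStar.norm_i_le x) (norm_nonneg _) (CStar.norm_i_le x)

/-- The Toeplitz representation of `ℕ` is faithful on the universal algebra of an isometry. -/
theorem piT_powers_injective (hb : Function.Injective fun n : ℤ => b ^ n) :
    Function.Injective (piT (Submonoid.powers b)) := by
  refine piT_injective_of_levelBound (powersGrading hb) (isQuasiLatticeOrdered_powers hb) ?_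
    (levelBound_powers hb)
  intro x y z hz
  have hle : ∀ w : Submonoid.powers b, PLe (Submonoid.powers b) (z : G) w →
      height (powersGrading hb) z ≤ height (powersGrading hb) w := by
    intro w h
    obtain ⟨v, rfl⟩ := h.exists_eq_mul
    rw [height_mul]; omega
  rcases powers_total x y with ⟨u, rfl⟩ | ⟨u, rfl⟩
  · exact (hle _ (hz.2 _ ⟨Subtype.prop _, pLe_mul _ _, pLe_refl _⟩)).trans (le_max_right _ _)
  · exact (hle _ (hz.2 _ ⟨Subtype.prop _, pLe_refl _, pLe_mul _ _⟩)).trans (le_max_left _ _)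

end Powers

end QuasiLattice

namespace QuasiLattice

variable {G : Type u} [Group G] {N P : Submonoid G}

/-! ### Faces of `P` -/

section Face

variable (hNP : N ≤ P)

theorem orthogonal_e_inclusion :
    OrthogonalFamily ℂ (fun _ : N => ℂ) (fun x =>
      LinearIsometry.toSpanSingleton ℂ (ell2 P) (orthonormal_e.1 (Submonoid.inclusion hNP x))) :=
  (orthonormal_e.comp _ (Submonoid.inclusion_injective hNP)).orthogonalFamily

/-- The inclusion of `ℓ²(N)` in `ℓ²(P)`. -/
def ell2Inclusion : ell2 N →ₗᵢ[ℂ] ell2 P := (orthogonal_e_inclusion hNP).linearIsometry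

theorem ell2Inclusion_e (x : N) : ell2Inclusion hNP (e x) = e (Submonoid.inclusion hNP x) := by
  classical
  rw [ell2Inclusion, e, OrthogonalFamily.linearIsometry_apply_single]
  simp

theorem ell2Inclusion_apply (f : ell2 N) (x : N) :
    ell2Inclusion hNP f (Submonoid.inclusion hNP x) = f x := by
  rw [← inner_e, ← ell2Inclusion_e, LinearIsometry.inner_map_map, inner_e]

theorem ell2Inclusion_apply_of_notMem (f : ell2 N) {p : P} (hp : (p : G) ∉ N) :
    ell2Inclusion hNP f p = 0 := by
  classical
  have h0 : ContinuousLinearMap.adjoint (ell2Inclusion hNP).toContinuousLinearMap (e p) = 0 := by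
    ext y
    rw [← inner_e, ContinuousLinearMap.adjoint_inner_right]
    show inner ℂ (ell2Inclusion hNP (e y)) (e p) = 0
    rw [ell2Inclusion_e, inner_e, e_apply, if_neg]
    rintro rfl
    exact hp y.2
  rw [← inner_e]
  show inner ℂ (e p) ((ell2Inclusion hNP).toContinuousLinearMap f) = 0
  rw [← ContinuousLinearMap.adjoint_inner_left, h0, inner_zero_left]

theorem T_inclusion (hface : ∀ x ∈ N, ∀ y ∈ P, x * y ∈ N → y ∈ N) (x : N) (f : ell2 N) :
    T (Submonoid.inclusion hNP x) (ell2Inclusion hNP f) = ell2Inclusion hNP (T x f) := by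
  ext p
  by_cases hx : PLe P (x : G) p
  · obtain ⟨w, rfl⟩ := PLe.exists_eq_mul (x := Submonoid.inclusion hNP x) hx
    rw [T_apply_mul]
    by_cases hw : (w : G) ∈ N
    · obtain ⟨v, rfl⟩ : ∃ v, w = Submonoid.inclusion hNP v := ⟨⟨w, hw⟩, rfl⟩
      rw [← map_mul, ell2Inclusion_apply, ell2Inclusion_apply, T_apply_mul]
    · rw [ell2Inclusion_apply_of_notMem hNP f hw, ell2Inclusion_apply_of_notMem]
      exact fun h => hw (hface x x.2 w w.2 h)
  · rw [T_apply_eq_zero _ _ hx]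
    by_cases hp : (p : G) ∈ N
    · obtain ⟨q, rfl⟩ : ∃ q, p = Submonoid.inclusion hNP q := ⟨⟨p, hp⟩, rfl⟩
      rw [ell2Inclusion_apply, T_apply_eq_zero]
      exact fun h => hx (hNP h)
    · rw [ell2Inclusion_apply_of_notMem hNP _ hp]

/-- The face condition keeps ℓ²(N) invariant under the adjoints: T_x⋆ e_{xy} = e_y, and y must lie
in N whenever x and xy do. -/
theorem star_T_inclusion (hface : ∀ x ∈ N, ∀ y ∈ P, x * y ∈ N → y ∈ N) (x : N) (f : ell2 N) :
    star (T (Submonoid.inclusion hNP x)) (ell2Inclusion hNP f) =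
      ell2Inclusion hNP (star (T x) f) := by
  ext p
  rw [star_T_apply]
  by_cases hp : (p : G) ∈ N
  · obtain ⟨q, rfl⟩ : ∃ q, p = Submonoid.inclusion hNP q := ⟨⟨p, hp⟩, rfl⟩
    rw [← map_mul, ell2Inclusion_apply, ell2Inclusion_apply, star_T_apply]
  · rw [ell2Inclusion_apply_of_notMem hNP _ hp, ell2Inclusion_apply_of_notMem]
    exact fun h => hp (hface x x.2 p p.2 h)

/-- A homomorphism `C⋆(G, N) → C⋆(G, P)` extending the inclusion is implemented in the Toeplitz
representations by the inclusion of `ℓ²(N)` in `ℓ²(P)`. -/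
theorem opT_ell2Inclusion (hface : ∀ x ∈ N, ∀ y ∈ P, x * y ∈ N → y ∈ N)
    (hN : IsQuasiLatticeOrdered N) (ι : CStar N →⋆ₐ[ℂ] CStar P)
    (hι : ∀ x, ι (CStar.i x) = CStar.i (Submonoid.inclusion hNP x)) (a : CStar N) (f : ell2 N) :
    opT (ι a) (ell2Inclusion hNP f) = ell2Inclusion hNP (opT a f) := by
  have hc : Continuous ι := by open scoped CStarAlgebra in exact map_continuous ι
  refine CStar.dense_induction hN (p := fun a =>
    opT (ι a) (ell2Inclusion hNP f) = ell2Inclusion hNP (opT a f)) ?_ ?_ ?_ ?_ ?_ a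
  · refine isClosed_eq ((continuous_opT.comp hc).clm_apply continuous_const) ?_
    exact (ell2Inclusion hNP).continuous.comp (continuous_opT.clm_apply continuous_const)
  · simp
  · intro a b ha hb
    rw [map_add, opT_add, opT_add, _root_.add_apply, _root_.add_apply, ha, hb, map_add]
  · intro c a ha
    rw [map_smul, opT_smul, opT_smul, _root_.smul_apply, _root_.smul_apply, ha, map_smul]
  · intro x y
    rw [map_mul, map_star, hι, hι, opT_mul, opT_mul, opT_star, opT_star, opT_i, opT_i, opT_i,
      opT_i, mul_apply_eq_comp, mul_apply_eq_comp, star_T_inclusion hNP hface,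
      T_inclusion hNP hface]

end Face

/-- If `x ∈ P` of height `k` factor through finitely many pairwise disjoint `σ` and elements of the
face `N` of height zero, then faithfulness of the Toeplitz representation of `N` gives a lower bound
on the level `k`. -/
theorem levelBound_of_stems (θ : P →* Multiplicative ℕ) (hNP : N ≤ P)
    (hzero : ∀ x : P, (x : G) ∈ N ↔ height θ x = 0) (hN : IsQuasiLatticeOrdered N)
    (hT : Function.Injective (piT N)) (ι : CStar N →⋆ₐ[ℂ] CStar P)
    (hι : ∀ x, ι (CStar.i x) = CStar.i (Submonoid.inclusion hNP x)) (k : ℕ) (S : Finset P)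
    (hS : ∀ σ ∈ S, height θ σ = k)
    (hfac : ∀ x : P, height θ x = k → ∃ σ ∈ S, ∃ n : N, x = σ * Submonoid.inclusion hNP n)
    (hdisj : ∀ σ ∈ S, ∀ τ ∈ S, σ ≠ τ → ¬ ∃ w, IsUpper P (σ : G) τ w) : LevelBound θ k := by
  classical
  have hface : ∀ x ∈ N, ∀ y ∈ P, x * y ∈ N → y ∈ N := fun x hx y hy hxy => by
    have h := (hzero (⟨x, hNP hx⟩ * ⟨y, hy⟩)).1 hxy
    rw [height_mul] at h
    exact (hzero ⟨y, hy⟩).2 (by omega)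
  have hστ : ∀ σ ∈ S, ∀ τ ∈ S, ∀ n : N,
      star (CStar.i σ) * CStar.i (τ * Submonoid.inclusion hNP n) =
        if σ = τ then CStar.i (Submonoid.inclusion hNP n) else 0 := by
    intro σ hσ τ hτ n
    rw [CStar.i_mul, ← mul_assoc]
    split_ifs with h
    · rw [h, CStar.star_i_mul_self, one_mul]
    · rw [CStar.star_i_mul_i_of_not_upper (hdisj σ hσ τ hτ h), zero_mul]
  -- The range projections of the σ ∈ S are orthogonal, and Q acts as a unit on the level k; cutting
  -- an element by Q on both sides gives its matrix over S.
  set Q : CStar P := ∑ σ ∈ S, CStar.i σ * star (CStar.i σ) with hQ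
  have hQstar : star Q = Q := by simp [hQ, star_sum]
  have hleft : ∀ x : P, height θ x = k → Q * CStar.i x = CStar.i x := by
    intro x hx
    obtain ⟨τ, hτ, n, rfl⟩ := hfac x hx
    rw [hQ, Finset.sum_mul, Finset.sum_eq_single_of_mem τ hτ]
    · rw [mul_assoc, hστ τ hτ τ hτ, if_pos rfl, CStar.i_mul]
    · intro σ hσ hne
      rw [mul_assoc, hστ σ hσ τ hτ, if_neg hne, mul_zero]
  have hQmul : ∀ a ∈ CStar.spanOn (fun x y : P => height θ x = k ∧ height θ y = k),
      Q * a = a := by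
    intro a ha
    refine CStar.spanOn_induction (p := fun a => Q * a = a) ?_ ?_ ?_ ?_ ha
    · simp
    · intro a b ha hb; rw [mul_add, ha, hb]
    · intro c a ha; rw [mul_smul_comm, ha]
    · rintro x y ⟨hx, -⟩
      rw [← mul_assoc, hleft x hx]
  -- The constant counts the matrix entries, each of which will have norm at most M.
  refine ⟨(S.card : ℝ) * S.card, by positivity, fun a ha M hM hf => ?_⟩
  have hdec : a = ∑ σ ∈ S, ∑ τ ∈ S,
      CStar.i σ * (star (CStar.i σ) * a * CStar.i τ) * star (CStar.i τ) := by
    have h : a = Q * a * Q := by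
      have h2 := hQmul (star a) (CStar.star_mem_spanOn (fun _ _ h => h.symm) ha)
      rw [← star_inj, star_mul, star_star, hQstar] at h2
      rw [hQmul a ha, h2]
    refine h.trans ?_
    simp only [hQ, Finset.sum_mul, Finset.mul_sum, mul_assoc]
    exact Finset.sum_comm
  have hent : ∀ σ ∈ S, ∀ τ ∈ S, ‖star (CStar.i σ) * a * CStar.i τ‖ ≤ M := by
    intro σ hσ τ hτ
    -- A matrix entry picks out the elements i(σn) i(τm)⋆ and leaves i(n) i(m)⋆, so it comes from
    -- C⋆(G, N), where the norm can be computed on ℓ²(N).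
    obtain ⟨r, hr⟩ : ∃ r, ι r = star (CStar.i σ) * a * CStar.i τ := by
      refine CStar.spanOn_induction (p := fun a => ∃ r, ι r = star (CStar.i σ) * a * CStar.i τ)
        ⟨0, by simp⟩ ?_ ?_ ?_ ha
      · rintro a b ⟨r, hr⟩ ⟨s, hs⟩
        exact ⟨r + s, by rw [map_add, hr, hs, mul_add, add_mul]⟩
      · rintro c a ⟨r, hr⟩
        exact ⟨c • r, by rw [map_smul, hr, mul_smul_comm, smul_mul_assoc]⟩
      · rintro x y ⟨hx, hy⟩
        obtain ⟨σ', hσ', n, rfl⟩ := hfac x hx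
        obtain ⟨τ', hτ', m, rfl⟩ := hfac y hy
        have e1 : star (CStar.i (τ' * Submonoid.inclusion hNP m)) * CStar.i τ =
            star (if τ = τ' then CStar.i (Submonoid.inclusion hNP m) else 0) := by
          rw [← hστ τ hτ τ' hτ', star_mul, star_star]
        rw [← mul_assoc, hστ σ hσ σ' hσ', mul_assoc, e1]
        split_ifs
        · exact ⟨CStar.i n * star (CStar.i m), by rw [map_mul, map_star, hι, hι]⟩
        all_goals exact ⟨0, by simp⟩
    rw [← hr]
    refine (open scoped CStarAlgebra in NonUnitalStarAlgHom.norm_apply_le ι r).trans ?_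
    rw [← norm_piT_of_injective hT]
    refine ContinuousLinearMap.opNorm_le_bound _ hM fun f => ?_
    have hiso : ∀ (x : P) (g : ell2 P), ‖T x g‖ = ‖g‖ := fun x g =>
      (orthogonal_e_mul x).linearIsometry.norm_map g
    have hstar : ∀ (x : P) (g : ell2 P), ‖star (T x) g‖ ≤ ‖g‖ := fun x g => by
      refine ((star (T x)).le_opNorm g).trans (mul_le_of_le_one_left (norm_nonneg g) ?_)
      rw [ContinuousLinearMap.star_eq_adjoint, LinearIsometryEquiv.norm_map]
      exact LinearIsometry.norm_toContinuousLinearMap_le _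
    rw [← (ell2Inclusion hNP).norm_map, ← opT_ell2Inclusion hNP hface hN ι hι, hr, opT_mul,
      opT_mul, opT_star, opT_i, opT_i, mul_apply_eq_comp, mul_apply_eq_comp]
    refine (hstar _ _).trans ((hf _ ?_).trans_eq ?_)
    -- T_τ moves ℓ²(N), which has height 0, to vectors supported in height k, so the hypothesis on
    -- level vectors applies.
    · intro p hp
      by_cases hle : PLe P (τ : G) p
      · obtain ⟨w, rfl⟩ := hle.exists_eq_mul
        rw [T_apply_mul, ell2Inclusion_apply_of_notMem]
        intro hw
        rw [hzero] at hw
        rw [height_mul, hS τ hτ, hw] at hp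
        exact hp rfl
      · exact T_apply_eq_zero _ _ hle _
    · rw [hiso, LinearIsometry.norm_map]
  rw [hdec]
  calc ‖∑ σ ∈ S, ∑ τ ∈ S, CStar.i σ * (star (CStar.i σ) * a * CStar.i τ) * star (CStar.i τ)‖
      ≤ ∑ σ ∈ S, ∑ τ ∈ S, M := by
        refine norm_sum_le_of_le _ fun σ hσ => norm_sum_le_of_le _ fun τ hτ => ?_
        refine (norm_mul_le _ _).trans ?_
        rw [norm_star]
        refine (mul_le_of_le_one_right (norm_nonneg _) (CStar.norm_i_le τ)).trans ?_
        refine (norm_mul_le _ _).trans ?_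
        exact (mul_le_of_le_one_left (norm_nonneg _) (CStar.norm_i_le σ)).trans (hent σ hσ τ hτ)
    _ = _ := by simp [mul_assoc]

end QuasiLattice

namespace BaumslagSolitar

variable {c d : ℕ}

/-! ### Stems -/

/-- The generator `a`. -/
def genA (c d : ℕ) : BS c d := PresentedGroup.of Gen.a

/-- The generator `b`. -/
def genB (c d : ℕ) : BS c d := PresentedGroup.of Gen.b

theorem genA_mul_pow : genA c d * genB c d ^ c = genB c d ^ d * genA c d := by
  have h : (PresentedGroup.mk {rel c d}) (FreeGroup.of Gen.a * FreeGroup.of Gen.b ^ c *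
      (FreeGroup.of Gen.b ^ d * FreeGroup.of Gen.a)⁻¹) = 1 :=
    PresentedGroup.one_of_mem (Set.mem_singleton _)
  rw [map_mul, map_inv, mul_inv_eq_one] at h
  simp only [map_mul, map_pow] at h
  exact h

theorem genA_mul_zpow (z : ℤ) :
    genA c d * genB c d ^ (c * z) = genB c d ^ (d * z) * genA c d := by
  have h : SemiconjBy (genA c d) (genB c d ^ c) (genB c d ^ d) := genA_mul_pow
  have := h.zpow_right z
  rw [← zpow_natCast, ← zpow_natCast, ← zpow_mul, ← zpow_mul] at this
  exact this

/-- The product of the `b^s a`, for `s` in a list. -/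
def stem (c d : ℕ) (l : List ℕ) : BS c d := (l.map fun s => genB c d ^ s * genA c d).prod

@[simp] theorem stem_nil : stem c d [] = 1 := rfl

theorem stem_cons (s : ℕ) (l : List ℕ) :
    stem c d (s :: l) = genB c d ^ s * genA c d * stem c d l := by
  simp [stem]

theorem stem_append (l l' : List ℕ) : stem c d (l ++ l') = stem c d l * stem c d l' := by
  simp [stem]

/-- Moving a power of `b` to the right of a stem. -/
theorem zpow_mul_stem (hd : 0 < d) (z : ℤ) (l : List ℕ) :
    ∃ (l' : List ℕ) (z' : ℤ), l'.length = l.length ∧ (∀ s ∈ l', s < d) ∧ (0 ≤ z → 0 ≤ z') ∧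
      genB c d ^ z * stem c d l = stem c d l' * genB c d ^ z' := by
  induction l generalizing z with
  | nil => exact ⟨[], z, rfl, by simp, id, by simp⟩
  | cons s l ih =>
    -- Divide z + s by d: the remainder becomes the new first exponent, and the quotient q passes
    -- the next a by b^{dq} a = a b^{cq}.
    obtain ⟨l', z', hlen, hlt, hz', h⟩ := ih (c * ((z + s) / d))
    have hd' : (0 : ℤ) < d := by exact_mod_cast hd
    have hmod := Int.emod_nonneg (z + s) hd'.ne'
    refine ⟨((z + s) % d).toNat :: l', z', by simp [hlen], ?_, ?_, ?_⟩
    · intro t ht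
      rcases List.mem_cons.1 ht with rfl | ht
      · have := Int.emod_lt_of_pos (z + s) hd'
        omega
      · exact hlt t ht
    · intro hz
      exact hz' (mul_nonneg (by positivity) (Int.ediv_nonneg (by omega) (by omega)))
    · have e1 : genB c d ^ z * genB c d ^ s =
          genB c d ^ ((z + s) % d).toNat * genB c d ^ (d * ((z + s) / d)) := by
        rw [← zpow_natCast, ← zpow_natCast, ← zpow_add, ← zpow_add, Int.toNat_of_nonneg hmod,
          Int.emod_add_mul_ediv]
      rw [stem_cons, stem_cons, mul_assoc _ (stem c d l'), ← h, ← mul_assoc, ← mul_assoc, e1,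
        mul_assoc _ _ (genA c d), ← genA_mul_zpow]
      simp only [mul_assoc]

/-- The set `P ⟨b⟩`. -/
def cone (c d : ℕ) : Set (BS c d) :=
  {g | ∃ (l : List ℕ) (z : ℤ), (∀ s ∈ l, s < d) ∧ g = stem c d l * genB c d ^ z}

theorem zpow_mul_mem_cone (hd : 0 < d) (z : ℤ) {g : BS c d} (hg : g ∈ cone c d) :
    genB c d ^ z * g ∈ cone c d := by
  obtain ⟨l, i, -, rfl⟩ := hg
  obtain ⟨l', z', -, hl', -, h⟩ := zpow_mul_stem (c := c) hd z l
  exact ⟨l', z' + i, hl', by rw [← mul_assoc, h, zpow_add, mul_assoc]⟩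

theorem genA_mem : genA c d ∈ P c d := Submonoid.subset_closure (by simp [genA])

theorem genB_mem : genB c d ∈ P c d := Submonoid.subset_closure (by simp [genB])

theorem stem_mem (l : List ℕ) : stem c d l ∈ P c d := by
  induction l with
  | nil => exact one_mem _
  | cons s l ih =>
    rw [stem_cons]
    exact mul_mem (mul_mem (pow_mem genB_mem s) genA_mem) ih

theorem zpow_mem {z : ℤ} (hz : 0 ≤ z) : genB c d ^ z ∈ P c d := by
  lift z to ℕ using hz
  rw [zpow_natCast]
  exact pow_mem genB_mem z

/-- Build g from the left. A new letter b raises the last exponent; a new letter a is preceded by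
some b^n, which is pushed across it without becoming negative. -/
theorem exists_stem_of_mem (hd : 0 < d) {g : BS c d} (hg : g ∈ P c d) :
    ∃ (l : List ℕ) (n : ℕ), (∀ s ∈ l, s < d) ∧ g = stem c d l * genB c d ^ n := by
  induction hg using Submonoid.closure_induction_right with
  | one => exact ⟨[], 0, by simp, by simp⟩
  | mul_right x hx y hy ih =>
    obtain ⟨l, n, hl, rfl⟩ := ih
    rcases hy with rfl | hy
    · obtain ⟨l', z', -, hl', hz', h⟩ := zpow_mul_stem (c := c) hd n [0]
      lift z' to ℕ using hz' (by positivity)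
      refine ⟨l ++ l', z', ?_, ?_⟩
      · intro s hs
        rcases List.mem_append.1 hs with h | h
        · exact hl s h
        · exact hl' s h
      · rw [stem_append, mul_assoc _ (stem c d l'), ← zpow_natCast _ z', ← h, stem_cons]
        simp only [stem_nil, pow_zero, one_mul, mul_one, zpow_natCast, mul_assoc]
        rfl
    · obtain rfl : y = PresentedGroup.of Gen.b := hy
      exact ⟨l, n + 1, hl, by rw [pow_succ, mul_assoc]; rfl⟩

theorem mem_cone_of_mem (hd : 0 < d) {g : BS c d} (hg : g ∈ P c d) : g ∈ cone c d := by
  obtain ⟨l, n, hl, rfl⟩ := exists_stem_of_mem hd hg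
  exact ⟨l, n, hl, by rw [zpow_natCast]⟩

/-- The homomorphism that counts `a`. -/
def heightHom (c d : ℕ) : BS c d →* Multiplicative ℤ :=
  PresentedGroup.toGroup (f := fun x => match x with
    | Gen.a => Multiplicative.ofAdd 1
    | Gen.b => 1) (by
      rintro _ rfl
      simp [rel])

theorem heightHom_genA : heightHom c d (genA c d) = Multiplicative.ofAdd 1 :=
  PresentedGroup.toGroup.of _

theorem heightHom_genB : heightHom c d (genB c d) = 1 :=
  PresentedGroup.toGroup.of _

theorem heightHom_stem (l : List ℕ) (z : ℤ) :
    heightHom c d (stem c d l * genB c d ^ z) = Multiplicative.ofAdd (l.length : ℤ) := by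
  rw [map_mul, map_zpow, heightHom_genB, one_zpow, mul_one]
  induction l with
  | nil => rw [stem_nil, map_one]; rfl
  | cons s l ih =>
    rw [stem_cons, map_mul, map_mul, map_pow, heightHom_genB, heightHom_genA, ih, one_pow, one_mul,
      ← ofAdd_add]
    simp [add_comm]

/-! ### Britton's lemma for the Baumslag-Solitar group -/

/-- The multiples of `n`, as a homomorphism of `ℤ`. -/
def multHom (n : ℕ) : Multiplicative ℤ →* Multiplicative ℤ :=
  zpowersHom (Multiplicative ℤ) (Multiplicative.ofAdd (n : ℤ))

theorem multHom_apply (n : ℕ) (z : ℤ) :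
    multHom n (Multiplicative.ofAdd z) = Multiplicative.ofAdd (n * z) := by
  rw [multHom, zpowersHom_apply, ← ofAdd_zsmul, smul_eq_mul, mul_comm]
  rfl

theorem multHom_injective {n : ℕ} (hn : 0 < n) : Function.Injective (multHom n) := by
  intro x y h
  have h' : Multiplicative.ofAdd ((n : ℤ) * x.toAdd) =
      Multiplicative.ofAdd ((n : ℤ) * y.toAdd) := by
    rw [← multHom_apply, ← multHom_apply]; exact h
  have h2 := Multiplicative.ofAdd.injective h'
  exact Multiplicative.toAdd.injective
    (mul_left_cancel₀ (by exact_mod_cast hn.ne' : (n : ℤ) ≠ 0) h2)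

theorem ofAdd_mem_range_multHom {n : ℕ} {z : ℤ} :
    Multiplicative.ofAdd z ∈ (multHom n).range ↔ (n : ℤ) ∣ z := by
  constructor
  · rintro ⟨x, hx⟩
    exact ⟨x.toAdd, Multiplicative.ofAdd.injective (hx.symm.trans (multHom_apply n x.toAdd))⟩
  · rintro ⟨k, rfl⟩
    exact ⟨Multiplicative.ofAdd k, multHom_apply n k⟩

/-- The isomorphism `c ℤ ≃ d ℤ`. -/
def multEquiv (hc : 0 < c) (hd : 0 < d) : (multHom c).range ≃* (multHom d).range :=
  (MonoidHom.ofInjective (multHom_injective hc)).symm.trans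
    (MonoidHom.ofInjective (multHom_injective hd))

/-- The HNN extension of `ℤ` that models the group. -/
abbrev Model (hc : 0 < c) (hd : 0 < d) : Type :=
  HNNExtension (Multiplicative ℤ) (multHom c).range (multHom d).range (multEquiv hc hd)

theorem model_rel (hc : 0 < c) (hd : 0 < d) :
    (HNNExtension.t : Model hc hd) * HNNExtension.of (Multiplicative.ofAdd (c : ℤ)) =
      HNNExtension.of (Multiplicative.ofAdd (d : ℤ)) * HNNExtension.t := by
  have hx : multHom c (Multiplicative.ofAdd 1) = Multiplicative.ofAdd (c : ℤ) := by
    rw [multHom_apply, mul_one]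
  have hy : multHom d (Multiplicative.ofAdd 1) = Multiplicative.ofAdd (d : ℤ) := by
    rw [multHom_apply, mul_one]
  have h := HNNExtension.t_mul_of (φ := multEquiv hc hd)
    (MonoidHom.ofInjective (multHom_injective hc) (Multiplicative.ofAdd 1))
  rw [multEquiv, MulEquiv.trans_apply, MulEquiv.symm_apply_apply] at h
  rw [← hx, ← hy]
  exact h

/-- The homomorphism to the HNN extension. -/
def toModel (hc : 0 < c) (hd : 0 < d) : BS c d →* Model hc hd :=
  PresentedGroup.toGroup (f := fun x => match x with
    | Gen.a => HNNExtension.t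
    | Gen.b => HNNExtension.of (Multiplicative.ofAdd 1)) (by
      rintro _ rfl
      rw [rel, map_mul, map_inv, mul_inv_eq_one]
      have h := model_rel hc hd
      simp only [map_mul, map_pow, FreeGroup.lift_apply_of]
      have hpow : ∀ n : ℕ, (HNNExtension.of (Multiplicative.ofAdd 1) : Model hc hd) ^ n =
          HNNExtension.of (Multiplicative.ofAdd (n : ℤ)) := fun n => by
        rw [← map_pow HNNExtension.of, ← ofAdd_nsmul, nsmul_one]
      rw [hpow, hpow]
      exact h)

theorem toModel_genA (hc : 0 < c) (hd : 0 < d) : toModel hc hd (genA c d) = HNNExtension.t :=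
  PresentedGroup.toGroup.of _

theorem toModel_zpow (hc : 0 < c) (hd : 0 < d) (z : ℤ) :
    toModel hc hd (genB c d ^ z) = HNNExtension.of (Multiplicative.ofAdd z) := by
  rw [map_zpow]
  have h : toModel hc hd (genB c d) = HNNExtension.of (Multiplicative.ofAdd 1) :=
    PresentedGroup.toGroup.of _
  rw [h, ← map_zpow HNNExtension.of, ← ofAdd_zsmul, zsmul_one]
  rfl

theorem genB_zpow_injective (hc : 0 < c) (hd : 0 < d) :
    Function.Injective fun z : ℤ => genB c d ^ z := by
  intro x y h
  have h' := congrArg (toModel hc hd) h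
  simp only [toModel_zpow] at h'
  exact Multiplicative.ofAdd.injective (HNNExtension.of_injective _ h')

/-- The value `b^h a^{u₁} b^{n₁} a^{u₂} b^{n₂} ⋯` of a word. -/
def wordVal (c d : ℕ) (w : ℤ × List (ℤˣ × ℤ)) : BS c d :=
  genB c d ^ w.1 * (w.2.map fun x => genA c d ^ (x.1 : ℤ) * genB c d ^ x.2).prod

/-- A word is reduced if it has no subword `a b^{cn} a⁻¹` or `a⁻¹ b^{dn} a`. -/
def IsReduced (c d : ℕ) (l : List (ℤˣ × ℤ)) : Prop :=
  l.IsChain fun x y => x.1 = y.1 ∨ (x.1 = 1 ∧ ¬ (c : ℤ) ∣ x.2) ∨ (x.1 = -1 ∧ ¬ (d : ℤ) ∣ x.2)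

/-- The reduced word in the HNN extension of a reduced word. -/
def toReducedWord (c d : ℕ) (w : ℤ × List (ℤˣ × ℤ)) (hw : IsReduced c d w.2) :
    HNNExtension.NormalWord.ReducedWord (Multiplicative ℤ) (multHom c).range (multHom d).range where
  head := Multiplicative.ofAdd w.1
  toList := w.2.map fun x => (x.1, Multiplicative.ofAdd x.2)
  chain := by
    rw [List.isChain_map]
    refine hw.imp ?_
    rintro ⟨u, m⟩ ⟨v, n⟩ h hm
    simp only at h hm ⊢
    rcases h with h | ⟨rfl, h⟩ | ⟨rfl, h⟩
    · exact h
    · rw [HNNExtension.toSubgroup_one, ofAdd_mem_range_multHom] at hm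
      exact absurd hm h
    · rw [HNNExtension.toSubgroup_neg_one, ofAdd_mem_range_multHom] at hm
      exact absurd hm h

theorem prod_toReducedWord (hc : 0 < c) (hd : 0 < d) (w : ℤ × List (ℤˣ × ℤ))
    (hw : IsReduced c d w.2) :
    (toReducedWord c d w hw).prod (multEquiv hc hd) = toModel hc hd (wordVal c d w) := by
  rw [HNNExtension.NormalWord.ReducedWord.prod, wordVal, map_mul, toModel_zpow, map_list_prod]
  simp only [toReducedWord, List.map_map]
  congr 2
  refine List.map_congr_left fun x _ => ?_
  simp only [Function.comp_apply, map_mul, toModel_zpow, map_zpow (toModel hc hd) (genA c d),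
    toModel_genA]

/-- Britton's lemma: reduced words with first letter `a⁻¹` and the same value have heads that agree
modulo `c`. -/
theorem head_congr_of_neg (hc : 0 < c) (hd : 0 < d) {h h' m m' : ℤ} {l l' : List (ℤˣ × ℤ)}
    (hl : IsReduced c d ((-1, m) :: l)) (hl' : IsReduced c d ((-1, m') :: l'))
    (heq : wordVal c d (h, (-1, m) :: l) = wordVal c d (h', (-1, m') :: l')) :
    (c : ℤ) ∣ h' - h := by
  have hp := (prod_toReducedWord hc hd (h, (-1, m) :: l) hl).trans
    ((congrArg (toModel hc hd) heq).trans (prod_toReducedWord hc hd (h', (-1, m') :: l') hl').symm)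
  -- For the first letter t⁻¹ the heads agree modulo the subgroup belonging to the opposite sign,
  -- here cℤ; for the first letter t it is dℤ.
  have := (HNNExtension.ReducedWord.map_fst_eq_and_of_prod_eq _ hp).2 (-1) (by
    simp [toReducedWord])
  rw [neg_neg, HNNExtension.toSubgroup_one] at this
  have e : (toReducedWord c d (h, (-1, m) :: l) hl).head⁻¹ *
      (toReducedWord c d (h', (-1, m') :: l') hl').head = Multiplicative.ofAdd (-h + h') := rfl
  rw [e, ofAdd_mem_range_multHom] at this
  rwa [neg_add_eq_sub] at this

theorem head_congr_of_pos (hc : 0 < c) (hd : 0 < d) {h h' m m' : ℤ} {l l' : List (ℤˣ × ℤ)}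
    (hl : IsReduced c d ((1, m) :: l)) (hl' : IsReduced c d ((1, m') :: l'))
    (heq : wordVal c d (h, (1, m) :: l) = wordVal c d (h', (1, m') :: l')) :
    (d : ℤ) ∣ h' - h := by
  have hp := (prod_toReducedWord hc hd (h, (1, m) :: l) hl).trans
    ((congrArg (toModel hc hd) heq).trans (prod_toReducedWord hc hd (h', (1, m') :: l') hl').symm)
  have := (HNNExtension.ReducedWord.map_fst_eq_and_of_prod_eq _ hp).2 1 (by
    simp [toReducedWord])
  rw [HNNExtension.toSubgroup_neg_one] at this
  have e : (toReducedWord c d (h, (1, m) :: l) hl).head⁻¹ *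
      (toReducedWord c d (h', (1, m') :: l') hl').head = Multiplicative.ofAdd (-h + h') := rfl
  rw [e, ofAdd_mem_range_multHom] at this
  rwa [neg_add_eq_sub] at this

/-! ### Reduced words of positive elements and of their quotients -/

/-- The word `b^{s₁} a b^{s₂} a ⋯ a b^z`. -/
def posWord (z : ℤ) : List ℕ → ℤ × List (ℤˣ × ℤ)
  | [] => (z, [])
  | s :: l => (s, (1, (posWord z l).1) :: (posWord z l).2)

theorem wordVal_cons (h : ℤ) (u : ℤˣ) (w : ℤ × List (ℤˣ × ℤ)) :
    wordVal c d (h, (u, w.1) :: w.2) =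
      genB c d ^ h * genA c d ^ (u : ℤ) * wordVal c d w := by
  simp [wordVal, mul_assoc]

theorem wordVal_posWord (z : ℤ) (l : List ℕ) :
    wordVal c d (posWord z l) = stem c d l * genB c d ^ z := by
  induction l with
  | nil => simp [posWord, wordVal]
  | cons s l ih => rw [posWord, wordVal_cons, ih, stem_cons]; simp [mul_assoc]

theorem posWord_fst_eq_one (z : ℤ) (l : List ℕ) : ∀ x ∈ (posWord z l).2, x.1 = 1 := by
  induction l with
  | nil => simp [posWord]
  | cons s l ih =>
    intro x hx
    rcases List.mem_cons.1 hx with rfl | hx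
    · rfl
    · exact ih x hx

/-- All letters have the same sign, so no pinch can occur. -/
theorem isReduced_posWord (z : ℤ) (l : List ℕ) : IsReduced c d (posWord z l).2 := by
  refine List.Pairwise.isChain (List.pairwise_of_forall_mem_list fun x hx y hy => Or.inl ?_)
  rw [posWord_fst_eq_one z l x hx, posWord_fst_eq_one z l y hy]

/-- The normal form of an element of the cone is unique. -/
theorem stem_mul_zpow_inj (hc : 0 < c) (hd : 0 < d) {l l' : List ℕ} {z z' : ℤ}
    (hl : ∀ s ∈ l, s < d) (hl' : ∀ s ∈ l', s < d)
    (h : stem c d l * genB c d ^ z = stem c d l' * genB c d ^ z') : l = l' ∧ z = z' := by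
  have hlen : l.length = l'.length := by
    have := congrArg (heightHom c d) h
    rw [heightHom_stem, heightHom_stem] at this
    exact_mod_cast Multiplicative.ofAdd.injective this
  induction l generalizing l' with
  | nil =>
    obtain rfl : l' = [] := List.length_eq_zero_iff.1 hlen.symm
    simp only [stem_nil, one_mul] at h
    exact ⟨rfl, genB_zpow_injective hc hd h⟩
  | cons s l ih =>
    cases l' with
    | nil => simp at hlen
    | cons s' l' =>
      have h1 := h
      rw [← wordVal_posWord, ← wordVal_posWord] at h1
      have h2 := head_congr_of_pos hc hd (isReduced_posWord z (s :: l))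
        (isReduced_posWord z' (s' :: l')) h1
      have hs := hl s (by simp)
      have hs' := hl' s' (by simp)
      -- Both exponents lie in [0, d) and are congruent modulo d.
      obtain rfl : s = s' := by
        have h0 : (s' : ℤ) - s = 0 := Int.eq_zero_of_abs_lt_dvd h2 (by
          rw [abs_lt]; constructor <;> omega)
        omega
      rw [stem_cons, stem_cons, mul_assoc _ (stem c d l), mul_assoc _ (stem c d l')] at h
      obtain ⟨rfl, rfl⟩ := ih (fun t ht => hl t (by simp [ht])) (fun t ht => hl' t (by simp [ht]))
        (mul_left_cancel h) (by simpa using hlen)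
      exact ⟨rfl, rfl⟩

/-- The word of `(stem r.reverse)⁻¹ w`. -/
def negWord (w : ℤ × List (ℤˣ × ℤ)) : List ℕ → ℤ × List (ℤˣ × ℤ)
  | [] => w
  | s :: r => (0, (-1, (negWord w r).1 - s) :: (negWord w r).2)

theorem wordVal_negWord (w : ℤ × List (ℤˣ × ℤ)) (r : List ℕ) :
    wordVal c d (negWord w r) = (stem c d r.reverse)⁻¹ * wordVal c d w := by
  induction r with
  | nil => simp [negWord]
  | cons s r ih =>
    have e : wordVal c d ((negWord w r).1 - s, (negWord w r).2) =
        genB c d ^ (-(s : ℤ)) * wordVal c d (negWord w r) := by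
      rw [wordVal, wordVal, ← mul_assoc, ← zpow_add, neg_add_eq_sub]
    rw [negWord, wordVal_cons 0 (-1) ((negWord w r).1 - s, (negWord w r).2), e, ih,
      List.reverse_cons, stem_append, stem_cons]
    simp [mul_assoc]

/-- The sign changes at most once, at a⁻¹ b^{s - s₀} a with s the first entry of `l`; as s ≠ s₀ are
both below d, this is not a pinch. -/
theorem isReduced_negWord {l : List ℕ} {z : ℤ} (s₀ : ℕ) (hs₀ : s₀ < d)
    (hl : ∀ s ∈ l, s < d) (hne : ∀ s ∈ l.head?, s ≠ s₀) (r : List ℕ) :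
    IsReduced c d (negWord (posWord z l) (r ++ [s₀])).2 := by
  induction r with
  | nil =>
    cases l with
    | nil => exact List.isChain_singleton _
    | cons s l =>
      refine List.isChain_cons_cons.2 ⟨Or.inr (Or.inr ⟨rfl, fun hdvd => ?_⟩),
        isReduced_posWord z (s :: l)⟩
      have h0 : (s : ℤ) - s₀ = 0 := Int.eq_zero_of_abs_lt_dvd hdvd (by
        have := hl s (by simp)
        rw [abs_lt]; constructor <;> omega)
      exact hne s (by simp) (by omega)
  | cons t r ih =>
    cases r with
    | nil => exact List.isChain_cons_cons.2 ⟨Or.inl rfl, ih⟩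
    | cons t' r => exact List.isChain_cons_cons.2 ⟨Or.inl rfl, ih⟩

/-- The second case includes `l'` being a proper prefix of `l`, with `t` empty. -/
theorem prefix_or_diverge (l l' : List ℕ) :
    l <+: l' ∨ ∃ ρ s r t, l = ρ ++ s :: r ∧ l' = ρ ++ t ∧ ∀ s' ∈ t.head?, s' ≠ s := by
  induction l generalizing l' with
  | nil => exact Or.inl List.nil_prefix
  | cons s l ih =>
    cases l' with
    | nil => exact Or.inr ⟨[], s, l, [], rfl, rfl, by simp⟩
    | cons s' l' =>
      by_cases h : s' = s
      · subst h
        rcases ih l' with h | ⟨ρ, u, r, t, rfl, rfl, h⟩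
        · exact Or.inl (List.cons_prefix_cons.2 ⟨rfl, h⟩)
        · exact Or.inr ⟨s' :: ρ, u, r, t, rfl, rfl, h⟩
      · exact Or.inr ⟨[], s, l, s' :: l', rfl, rfl, by simpa using h⟩

/-- If `w` and `w g` lie in the cone but `g` does not, then `g` has a reduced word starting with
`b^{-i} a⁻¹`, where `b^i` is the last power of `b` in `w`. -/
theorem exists_reduced_of_notMem_cone (hd : 0 < d) {l : List ℕ} {i : ℤ} {g : BS c d}
    (hl : ∀ s ∈ l, s < d) (hmem : stem c d l * genB c d ^ i * g ∈ cone c d)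
    (hg : g ∉ cone c d) :
    ∃ m L, IsReduced c d ((-1, m) :: L) ∧ g = wordVal c d (-i, (-1, m) :: L) := by
  obtain ⟨l', i', hl', h⟩ := hmem
  have hg' : g = genB c d ^ (-i) * ((stem c d l)⁻¹ * (stem c d l' * genB c d ^ i')) := by
    rw [← h]; group
  -- If `l` is a prefix of the stem of w g, cancelling it leaves g in the cone. Otherwise the common
  -- part ρ cancels and an inverse stem remains in front, with no further cancellation.
  rcases prefix_or_diverge l l' with ⟨t, rfl⟩ | ⟨ρ, s, r, t, rfl, rfl, hne⟩
  · refine absurd ?_ hg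
    rw [hg', stem_append, mul_assoc, inv_mul_cancel_left]
    exact zpow_mul_mem_cone hd _ ⟨t, i', fun s hs => hl' s (by simp [hs]), rfl⟩
  · have hred := isReduced_negWord (c := c) (d := d) (z := i') s (hl s (by simp))
      (fun s hs => hl' s (by simp [hs])) hne r.reverse
    have hval := wordVal_negWord (c := c) (d := d) (posWord i' t) (r.reverse ++ [s])
    obtain ⟨m, L, hmL⟩ : ∃ m L, negWord (posWord i' t) (r.reverse ++ [s]) = (0, (-1, m) :: L) := by
      cases r.reverse with
      | nil => exact ⟨_, _, rfl⟩
      | cons => exact ⟨_, _, rfl⟩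
    rw [hmL] at hred hval
    refine ⟨m, L, hred, ?_⟩
    have e : wordVal c d (-i, (-1, m) :: L) = genB c d ^ (-i) * wordVal c d (0, (-1, m) :: L) := by
      simp [wordVal]
    rw [e, hval, wordVal_posWord, hg', stem_append, stem_append]
    simp [mul_assoc]

end BaumslagSolitar

namespace BaumslagSolitar

open QuasiLattice

variable {c d : ℕ}

/-! ### The quasi-lattice order -/

theorem zpow_mul_genA_inv (y : ℤ) :
    genB c d ^ (c * y) * (genA c d)⁻¹ = (genA c d)⁻¹ * genB c d ^ (d * y) := by
  rw [eq_inv_mul_iff_mul_eq, ← mul_assoc, genA_mul_zpow, mul_inv_cancel_right]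

/-- Exponents divisible by c are exactly those for which a trailing a⁻¹ removes the last a of the
stem; this shortens cone elements in `exists_cone_inter`. -/
theorem stem_concat_mul_genA_inv (l : List ℕ) (s : ℕ) (y : ℤ) :
    stem c d (l ++ [s]) * (genB c d ^ (c * y) * (genA c d)⁻¹) =
      stem c d l * genB c d ^ (s + d * y) := by
  rw [zpow_mul_genA_inv, stem_append, stem_cons, zpow_add, zpow_natCast]
  simp [mul_assoc]

/-- Two translates of the cone that meet intersect in a translate of the cone. -/
theorem exists_cone_inter (hc : 0 < c) (hd : 0 < d) (g : BS c d)
    (hg : ∃ w ∈ cone c d, g⁻¹ * w ∈ cone c d) :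
    ∃ z ∈ cone c d, g⁻¹ * z ∈ cone c d ∧
      ∀ w ∈ cone c d, g⁻¹ * w ∈ cone c d → z⁻¹ * w ∈ cone c d := by
  classical
  have hex : ∃ n, ∃ (l : List ℕ) (i : ℤ), l.length = n ∧ (∀ s ∈ l, s < d) ∧
      g⁻¹ * (stem c d l * genB c d ^ i) ∈ cone c d := by
    obtain ⟨_, ⟨l, i, hl, rfl⟩, h⟩ := hg
    exact ⟨_, l, i, rfl, hl, h⟩
  -- Choose w in the intersection with the shortest stem. If some w' in the intersection were not in
  -- w times the cone, w could be shortened.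
  obtain ⟨l, i, hlen, hl, hv⟩ := Nat.find_spec hex
  refine ⟨_, ⟨l, i, hl, rfl⟩, hv, fun w' hw' hv' => ?_⟩
  by_contra hcone
  set w := stem c d l * genB c d ^ i with hw
  obtain ⟨κ, j, hκ, hv⟩ := hv
  have hw1 : w * (w⁻¹ * w') ∈ cone c d := by rwa [mul_inv_cancel_left]
  have hv1 : stem c d κ * genB c d ^ j * (w⁻¹ * w') ∈ cone c d := by
    rw [← hv]
    simpa [mul_assoc] using hv'
  obtain ⟨m, L, hred, hval⟩ := exists_reduced_of_notMem_cone hd hl hw1 hcone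
  obtain ⟨m', L', hred', hval'⟩ := exists_reduced_of_notMem_cone hd hκ hv1 hcone
  -- The element w⁻¹ w' has reduced words starting with b^{-i} a⁻¹ (seen from w) and with b^{-j} a⁻¹
  -- (seen from g⁻¹ w), so j - i is a multiple of c.
  obtain ⟨y, hy⟩ := head_congr_of_neg hc hd hred' hred (hval'.symm.trans hval)
  rcases List.eq_nil_or_concat' κ with rfl | ⟨κ, s', rfl⟩
  · refine hcone ?_
    have := zpow_mul_mem_cone hd (-j) hv1
    simpa using this
  rcases List.eq_nil_or_concat' l with rfl | ⟨l, s, rfl⟩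
  · refine hcone ?_
    have h1 : w' = genB c d ^ i * (w⁻¹ * w') := by rw [hw]; simp
    have := zpow_mul_mem_cone hd (-i) hw'
    rw [h1] at this
    simpa using this
  -- Multiplying w on the right by b^{-i} a⁻¹ removes its last a. The same factor also removes the
  -- last a of g⁻¹ w because c divides j - i, so both stay in the cone.
  refine Nat.find_min hex (m := l.length) (by rw [← hlen]; simp)
    ⟨l, s, rfl, fun t ht => hl t (by simp [ht]), ?_⟩
  have e1 : stem c d l * genB c d ^ (s : ℤ) = w * (genB c d ^ (-i) * (genA c d)⁻¹) := by
    have := stem_concat_mul_genA_inv (c := c) (d := d) l s 0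
    simp only [mul_zero, add_zero, zpow_zero, one_mul] at this
    rw [← this, hw]
    group
  have e2 : genB c d ^ j * (genB c d ^ (-i) * (genA c d)⁻¹) =
      genB c d ^ (c * y) * (genA c d)⁻¹ := by
    rw [← mul_assoc, ← zpow_add, ← hy]
    congr 2
    ring
  rw [e1, ← mul_assoc, hv, mul_assoc, e2, stem_concat_mul_genA_inv]
  exact ⟨κ, _, fun t ht => hκ t (by simp [ht]), rfl⟩

/-- Removing an initial stem does not change the final exponent of b, by uniqueness of the normal
form, so this exponent stays nonnegative. -/
theorem inv_stem_mul_mem (hc : 0 < c) (hd : 0 < d) {l : List ℕ} (hl : ∀ s ∈ l, s < d) {w : BS c d}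
    (hw : w ∈ P c d) (h : (stem c d l)⁻¹ * w ∈ cone c d) : (stem c d l)⁻¹ * w ∈ P c d := by
  obtain ⟨l', n, hl', rfl⟩ := exists_stem_of_mem hd hw
  obtain ⟨l₂, z, hl₂, h⟩ := h
  rw [h]
  rw [inv_mul_eq_iff_eq_mul, ← mul_assoc, ← stem_append, ← zpow_natCast] at h
  obtain ⟨-, rfl⟩ := stem_mul_zpow_inj hc hd hl' (fun s hs => by
    rcases List.mem_append.1 hs with h | h
    exacts [hl s h, hl₂ s h]) h
  exact mul_mem (stem_mem _) (zpow_mem (by positivity))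

/-- Two translates of `P` that meet intersect in a translate of `P`. -/
theorem exists_inter (hc : 0 < c) (hd : 0 < d) (g : BS c d)
    (hg : ∃ w ∈ P c d, g⁻¹ * w ∈ P c d) :
    ∃ z ∈ P c d, g⁻¹ * z ∈ P c d ∧ ∀ w ∈ P c d, g⁻¹ * w ∈ P c d → z⁻¹ * w ∈ P c d := by
  obtain ⟨_, ⟨l, i, hl, rfl⟩, ⟨κ, j, hκ, hz⟩, hmin⟩ := exists_cone_inter hc hd g (by
    obtain ⟨w, hw, hw'⟩ := hg
    exact ⟨w, mem_cone_of_mem hd hw, mem_cone_of_mem hd hw'⟩)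
  have hσ : g⁻¹ * stem c d l = stem c d κ * genB c d ^ (j - i) := by
    rw [zpow_sub, ← mul_assoc, ← hz]
    group
  have key : ∀ w ∈ P c d, g⁻¹ * w ∈ P c d → (stem c d l)⁻¹ * w ∈ P c d ∧
      genB c d ^ (-(i - j)) * ((stem c d l)⁻¹ * w) ∈ P c d := by
    intro w hw hw'
    have h1 : (stem c d l)⁻¹ * w ∈ cone c d := by
      have := zpow_mul_mem_cone hd i (hmin w (mem_cone_of_mem hd hw) (mem_cone_of_mem hd hw'))
      rw [mul_inv_rev, mul_assoc, mul_inv_cancel_left] at this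
      exact this
    have h2 : genB c d ^ (-(i - j)) * ((stem c d l)⁻¹ * w) = (stem c d κ)⁻¹ * (g⁻¹ * w) := by
      have : g⁻¹ = stem c d κ * genB c d ^ (j - i) * (stem c d l)⁻¹ := by
        rw [← hσ, mul_inv_cancel_right]
      rw [this, neg_sub]
      group
    refine ⟨inv_stem_mul_mem hc hd hl hw h1, ?_⟩
    rw [h2]
    exact inv_stem_mul_mem hc hd hκ hw' (h2 ▸ zpow_mul_mem_cone hd _ h1)
  -- With σ the stem of the cone solution, σ b^m and g⁻¹ σ b^m = κ b^{j - i + m}, κ a stem, lie in P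
  -- when m ≥ 0 and m ≥ i - j; the least such m is taken.
  refine ⟨stem c d l * genB c d ^ (max 0 (i - j)),
    mul_mem (stem_mem _) (zpow_mem (le_max_left _ _)), ?_, fun w hw hw' => ?_⟩
  · rw [← mul_assoc, hσ, mul_assoc, ← zpow_add]
    exact mul_mem (stem_mem _) (zpow_mem (by omega))
  · obtain ⟨h1, h2⟩ := key w hw hw'
    rw [mul_inv_rev, mul_assoc, ← zpow_neg]
    rcases max_choice 0 (i - j) with h | h
    · rw [h]; simpa using h1
    · rw [h]; exact h2

theorem isQuasiLatticeOrdered (hc : 0 < c) (hd : 0 < d) : IsQuasiLatticeOrdered (P c d) where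
  eq_one x hx hx' := by
    obtain ⟨l, n, hl, rfl⟩ := exists_stem_of_mem hd hx
    obtain ⟨l', n', hl', h⟩ := exists_stem_of_mem hd hx'
    rw [← zpow_natCast] at h ⊢
    rw [← zpow_natCast] at h
    -- The heights of x and x⁻¹ are nonnegative and opposite, so neither element contains a; the
    -- exponents of b are then opposite as well.
    have h1 := congrArg (heightHom c d) h
    rw [map_inv, heightHom_stem, heightHom_stem, ← ofAdd_neg] at h1
    have h2 : -(l.length : ℤ) = l'.length := Multiplicative.ofAdd.injective h1
    obtain rfl : l = [] := List.length_eq_zero_iff.1 (by omega)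
    obtain rfl : l' = [] := List.length_eq_zero_iff.1 (by simpa using h2.symm)
    rw [stem_nil, one_mul, one_mul, ← zpow_neg] at h
    have h3 : -(n : ℤ) = n' := genB_zpow_injective hc hd h
    have h4 : n = 0 := by omega
    simp [h4]
  exists_join g h := by
    rintro ⟨w, hw, hgw, hhw⟩
    -- Three translates are intersected in two stages: P ∩ gP = z₁P, and then z₁P ∩ hP = z₁(P ∩
    -- z₁⁻¹hP) = z₁z₂P.
    obtain ⟨z₁, hz₁, hgz₁, hmin₁⟩ := exists_inter hc hd g ⟨w, hw, hgw⟩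
    have e : ∀ v : BS c d, (z₁⁻¹ * h)⁻¹ * (z₁⁻¹ * v) = h⁻¹ * v := fun v => by group
    obtain ⟨z₂, hz₂, hhz₂, hmin₂⟩ := exists_inter hc hd (z₁⁻¹ * h)
      ⟨z₁⁻¹ * w, hmin₁ w hw hgw, by rw [e]; exact hhw⟩
    refine ⟨z₁ * z₂, ⟨mul_mem hz₁ hz₂, ?_, ?_⟩, ?_⟩
    · rw [PLe, ← mul_assoc]; exact mul_mem hgz₁ hz₂
    · have := e (z₁ * z₂)
      rw [inv_mul_cancel_left] at this
      rw [PLe, ← this]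
      exact hhz₂
    · rintro v ⟨hv, hgv, hhv⟩
      have := hmin₂ (z₁⁻¹ * v) (hmin₁ v hv hgv) (by rw [e]; exact hhv)
      rw [PLe, mul_inv_rev, mul_assoc]
      exact this

/-! ### The height -/

theorem heightHom_nonneg (hd : 0 < d) {g : BS c d} (hg : g ∈ P c d) :
    0 ≤ (heightHom c d g).toAdd := by
  obtain ⟨l, n, hl, rfl⟩ := exists_stem_of_mem hd hg
  rw [← zpow_natCast, heightHom_stem]
  exact Int.natCast_nonneg _

/-- The number of letters `a` in an element of `P`. -/
def grading (hd : 0 < d) : P c d →* Multiplicative ℕ where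
  toFun x := Multiplicative.ofAdd (heightHom c d x).toAdd.toNat
  map_one' := by simp
  map_mul' x y := by
    have hx := heightHom_nonneg hd x.2
    have hy := heightHom_nonneg hd y.2
    rw [← ofAdd_add]
    congr 1
    rw [Submonoid.coe_mul, map_mul, toAdd_mul, Int.toNat_add hx hy]

theorem height_grading (hd : 0 < d) {x : P c d} {l : List ℕ} {z : ℤ}
    (hx : (x : BS c d) = stem c d l * genB c d ^ z) : height (grading hd) x = l.length := by
  show (heightHom c d x).toAdd.toNat = l.length
  rw [hx, heightHom_stem]
  simp

theorem exists_stem (hd : 0 < d) (x : P c d) :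
    ∃ (l : List ℕ) (n : ℕ), (∀ s ∈ l, s < d) ∧ (x : BS c d) = stem c d l * genB c d ^ n ∧
      height (grading hd) x = l.length := by
  obtain ⟨l, n, hl, h⟩ := exists_stem_of_mem hd x.2
  exact ⟨l, n, hl, h, height_grading hd (z := n) (by rw [h, zpow_natCast])⟩

/-- Elements of `P` of equal height with a common upper bound have the same stem. -/
theorem stem_eq_of_upper (hc : 0 < c) (hd : 0 < d) {l l' : List ℕ} (hl : ∀ s ∈ l, s < d)
    (hl' : ∀ s ∈ l', s < d) (hlen : l.length = l'.length) {n n' : ℕ} {p p' : BS c d}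
    (hp : p ∈ P c d) (hp' : p' ∈ P c d)
    (h : stem c d l * genB c d ^ n * p = stem c d l' * genB c d ^ n' * p') : l = l' := by
  have key : ∀ (n : ℕ) (p : BS c d), p ∈ P c d → genB c d ^ n * p ∈ cone c d := fun n p hp =>
    mem_cone_of_mem hd (mul_mem (pow_mem genB_mem n) hp)
  obtain ⟨l₁, z, hl₁, h₁⟩ := key n p hp
  obtain ⟨l₂, z', hl₂, h₂⟩ := key n' p' hp'
  rw [mul_assoc, mul_assoc, h₁, h₂, ← mul_assoc, ← mul_assoc, ← stem_append, ← stem_append] at h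
  refine List.append_inj_left (stem_mul_zpow_inj hc hd ?_ ?_ h).1 hlen
  · intro s hs
    rcases List.mem_append.1 hs with h | h
    exacts [hl s h, hl₁ s h]
  · intro s hs
    rcases List.mem_append.1 hs with h | h
    exacts [hl' s h, hl₂ s h]

theorem exists_factor_of_height_le (hd : 0 < d) (p : P c d) {k : ℕ}
    (hk : k ≤ height (grading hd) p) :
    ∃ q r : P c d, p = q * r ∧ height (grading hd) q = k := by
  obtain ⟨l, n, hl, hp, hlen⟩ := exists_stem hd p
  refine ⟨⟨stem c d (l.take k), stem_mem _⟩,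
    ⟨stem c d (l.drop k) * genB c d ^ n, mul_mem (stem_mem _) (pow_mem genB_mem n)⟩, ?_, ?_⟩
  · refine Subtype.ext ?_
    rw [hp]
    show _ = stem c d (l.take k) * (stem c d (l.drop k) * genB c d ^ n)
    rw [← mul_assoc, ← stem_append, List.take_append_drop]
  · rw [height_grading hd (l := l.take k) (z := 0) (by simp), List.length_take]
    omega

/-- Cut the path from x to w at the height of y. The element x p₀ reached there and y lie below w at
equal height, so they have the same stem and differ by a power of b; the larger one bounds x and y.
-/
theorem exists_upper_height_le (hc : 0 < c) (hd : 0 < d) {x y w : P c d}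
    (hle : height (grading hd) x ≤ height (grading hd) y) (hx : PLe (P c d) (x : BS c d) w)
    (hy : PLe (P c d) (y : BS c d) w) :
    ∃ v : P c d, IsUpper (P c d) (x : BS c d) y v ∧
      height (grading hd) v = height (grading hd) y := by
  obtain ⟨p, rfl⟩ := hx.exists_eq_mul
  obtain ⟨q, hq⟩ := hy.exists_eq_mul
  have hh := congrArg (height (grading hd)) hq
  rw [height_mul, height_mul] at hh
  obtain ⟨p₀, p₁, rfl, hp₀⟩ := exists_factor_of_height_le hd p
    (k := height (grading hd) y - height (grading hd) x) (by omega)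
  have hxp : height (grading hd) (x * p₀) = height (grading hd) y := by
    rw [height_mul]; omega
  obtain ⟨l, n, hl, hl1, hl2⟩ := exists_stem hd (x * p₀)
  obtain ⟨l', n', hl', hl1', hl2'⟩ := exists_stem hd y
  obtain rfl : l = l' := by
    refine stem_eq_of_upper hc hd hl hl' (by omega) p₁.2 q.2 (n := n) (n' := n') ?_
    rw [← hl1, ← hl1']
    have := congrArg Subtype.val hq
    simpa [mul_assoc] using this
  rcases le_total n n' with h | h
  · refine ⟨y, ⟨y.2, ?_, pLe_refl _⟩, rfl⟩
    have : y = x * (p₀ * ⟨genB c d ^ (n' - n), pow_mem genB_mem _⟩) := by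
      refine Subtype.ext ?_
      rw [← mul_assoc, Submonoid.coe_mul, hl1, hl1', mul_assoc, pow_mul_pow_sub _ h]
    rw [this]
    exact pLe_mul _ _
  · refine ⟨x * p₀, ⟨Subtype.prop _, pLe_mul _ _, ?_⟩, hxp⟩
    have : x * p₀ = y * ⟨genB c d ^ (n - n'), pow_mem genB_mem _⟩ := by
      refine Subtype.ext ?_
      rw [hl1, Submonoid.coe_mul, hl1', mul_assoc, pow_mul_pow_sub _ h]
    rw [this]
    exact pLe_mul _ _

theorem height_join_le (hc : 0 < c) (hd : 0 < d) (x y z : P c d)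
    (hz : IsJoin (P c d) (x : BS c d) y z) :
    height (grading hd) z ≤ max (height (grading hd) x) (height (grading hd) y) := by
  have hmono : ∀ v : P c d, PLe (P c d) (z : BS c d) v →
      height (grading hd) z ≤ height (grading hd) v := by
    intro v h
    obtain ⟨u, rfl⟩ := h.exists_eq_mul
    rw [height_mul]; omega
  rcases le_total (height (grading hd) x) (height (grading hd) y) with h | h
  · obtain ⟨v, hv, hv'⟩ := exists_upper_height_le hc hd h hz.1.2.1 hz.1.2.2
    exact (hmono v (hz.2 v hv)).trans (hv'.le.trans (le_max_right _ _))
  · obtain ⟨v, hv, hv'⟩ := exists_upper_height_le hc hd h hz.1.2.2 hz.1.2.1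
    exact (hmono v (hz.2 v ⟨hv.1, hv.2.2, hv.2.1⟩)).trans (hv'.le.trans (le_max_left _ _))

/-! ### Faithfulness of the Toeplitz representation -/

theorem powers_le : Submonoid.powers (genB c d) ≤ P c d := by
  rw [Submonoid.powers_le]
  exact genB_mem

theorem piT_injective (hc : 0 < c) (hd : 0 < d) : Function.Injective (piT (P c d)) := by
  classical
  have hb := genB_zpow_injective hc hd
  have hV : ∀ x, star (CStar.i (Submonoid.inclusion (powers_le (c := c) (d := d)) x)) *
      CStar.i (Submonoid.inclusion powers_le x) = 1 := fun x => CStar.star_i_mul_self _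
  let ι := CStar.lift (NicaRep.ofPowers hb
    ((CStar.univ (P c d)).toHom.comp (Submonoid.inclusion powers_le)) hV)
  have hι : ∀ x, ι (CStar.i x) = CStar.i (Submonoid.inclusion powers_le x) := fun x =>
    CStar.lift_i _ x
  refine piT_injective_of_levelBound (grading hd) (isQuasiLatticeOrdered hc hd)
    (height_join_le hc hd) fun k => ?_
  -- The reduced stems of height k are indexed by k exponents below d, which makes the set of stems
  -- finite.
  let f : (Fin k → Fin d) → P c d := fun v => ⟨stem c d (List.ofFn fun j => (v j : ℕ)), stem_mem _⟩
  have hf : ∀ v : Fin k → Fin d, ∀ s ∈ List.ofFn fun j => (v j : ℕ), s < d := by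
    intro v s hs
    obtain ⟨j, rfl⟩ := (List.mem_ofFn' _ _).1 hs
    exact (v j).2
  refine levelBound_of_stems (grading hd) powers_le ?_ (isQuasiLatticeOrdered_powers hb)
    (piT_powers_injective hb) ι hι k (Finset.univ.image f) ?_ ?_ ?_
  · intro x
    obtain ⟨l, n, hl, hx, hlen⟩ := exists_stem hd x
    rw [hlen, hx, List.length_eq_zero_iff]
    constructor
    · rintro ⟨m, hm⟩
      have hm' : stem c d [] * genB c d ^ (m : ℤ) = stem c d l * genB c d ^ (n : ℤ) := by
        simpa using hm
      exact (stem_mul_zpow_inj hc hd (by simp) hl hm').1.symm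
    · rintro rfl
      exact ⟨n, by simp⟩
  · intro σ hσ
    obtain ⟨v, -, rfl⟩ := Finset.mem_image.1 hσ
    rw [height_grading hd (l := List.ofFn fun j => (v j : ℕ)) (z := 0) (by simp [f]),
      List.length_ofFn]
  · intro x hx
    obtain ⟨l, n, hl, hx', hlen⟩ := exists_stem hd x
    obtain rfl : l.length = k := hlen.symm.trans hx
    refine ⟨f fun j => ⟨l[j], hl _ (List.getElem_mem _)⟩,
      Finset.mem_image_of_mem _ (Finset.mem_univ _),
      ⟨genB c d ^ n, n, rfl⟩, Subtype.ext ?_⟩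
    rw [hx']
    show _ = stem c d (List.ofFn fun j : Fin l.length => l[j]) * genB c d ^ n
    congr 2
    exact List.ofFn_getElem.symm
  · intro σ hσ τ hτ hne
    obtain ⟨v, -, rfl⟩ := Finset.mem_image.1 hσ
    obtain ⟨v', -, rfl⟩ := Finset.mem_image.1 hτ
    rintro ⟨w, hw, hv, hv'⟩
    refine hne (Subtype.ext (congrArg (stem c d) ?_))
    refine stem_eq_of_upper hc hd (hf v) (hf v') (by simp) hv hv' (n := 0) (n' := 0) ?_
    simp [f]

end BaumslagSolitar

end

theorem theoremA1 (c d : ℕ) (hc : 0 < c) (hd : 0 < d) :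
    QuasiLattice.IsAmenable (BaumslagSolitar.P c d) ∧
      Function.Injective (QuasiLattice.piT (BaumslagSolitar.P c d)) := by
  exact ⟨QuasiLattice.isAmenable_of_injective (BaumslagSolitar.isQuasiLatticeOrdered hc hd)
    (BaumslagSolitar.piT_injective hc hd), BaumslagSolitar.piT_injective hc hd⟩
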